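/- There is a universal constant $C>0$ with the following property. Let $d\ge 1$, $\beta,\rho>0$, and let $g:\mathbb{R}^d\to\mathbb{R}$ be twice continuously differentiable with $g\ge g_{\mathrm{lb}}>-\infty$, with $\beta$-Lipschitz gradient, and with $2\rho$-Lipschitz Hessian: $\|\nabla^2 g(y)-\nabla^2 g(y')\|_{\mathrm{op}}\le 2\rho\|y-y'\|$. Let $y_0\in\mathbb{R}^d$ with $g(y_0)>g_{\mathrm{lb}}$, $\delta\in(0,1]$ and $0<\epsilon\le\min\{\beta^2/\rho,\rho^{1/3}\}$. Then with probability at least $1-\delta$ the following algorithm halts, its output $y$ is an $\epsilon$-second-order stationary point, $$\|\nabla g(y)\|\le\epsilon\quad\text{and}\quad \nabla^2 g(y)\succeq-\sqrt{\rho\epsilon}\,I ,$$ and it makes at most $$C\cdot\frac{\beta\lceil g(y_0)-g_{\mathrm{lb}}\rceil}{\epsilon^2}\cdot\max\left\{1,\ \log\left(\frac d\delta\cdot\frac{\beta\lceil g(y_0)-g_{\mathrm{lb}}\rceil}{\epsilon^2}\right)\right\}$$ gradient evaluations $\nabla g(y)$ and Hessian-vector product evaluations $\nabla^2g(y)v$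 in total. **Algorithm.** For a symmetric $A$ and a vector $b$ write $f_{A,b}(x)=\tfrac12x^{\mathsf T}Ax+b^{\mathsf T}x+\tfrac\rho3\|x\|^3$, and let the Cauchy point be $\mathrm{CP}(A,b)=-R_c\,b/\|b\|$ (which is $0$ if $b=0$), where $R_c=-\frac{b^{\mathsf T}Ab}{2\rho\|b\|^2}+\sqrt{\left(\frac{b^{\mathsf T}Ab}{2\rho\|b\|^2}\right)^2+\frac{\|b\|}{\rho}}$. Set $\kappa=1/324$, $\eta=1/(10\beta)$, $K_{\max}=\lceil (g(y_0)-g_{\mathrm{lb}})\sqrt\rho/(\kappa\epsilon^{3/2})\rceil$, $\delta'=\delta/K_{\max}$, $\ell=\sqrt{\epsilon/(9\rho)}$, $\epsilon'=1/2$. The matrix $A$ below is accessed only through products $Av$. For $k=1,2,\dots$: 1. Let $A=\nabla^2g(y_{k-1})$, $b=\nabla g(y_{k-1})$, and compute $\Delta_k$ as follows. Let $x_0=\mathrm{CP}(A,b)$. If $f_{A,b}(x_0)\le-(1-\epsilon')\rho\ell^3/6$, put $\Delta_k=x_0$. Otherwise draw $q$ uniformly from the unit sphere, independently of all previous draws,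 let $\sigma=\frac{\rho^2\ell^3\epsilon'}{144(\beta+2\rho\ell)}$, $\tilde b=b+\sigma q$, $\tilde x_0=\mathrm{CP}(A,\tilde b)$, and for $t=1,\dots,T$ let $\tilde x_t=\tilde x_{t-1}-\eta\nabla f_{A,\tilde b}(\tilde x_{t-1})$, stopping with $\Delta_k=\tilde x_t$ as soon as $f_{A,b}(\tilde x_t)\le-(1-\epsilon')\rho\ell^3/6$, and putting $\Delta_k=\tilde x_T$ if this never happens. Here $$T=\left\lceil\frac{240}{\eta\rho\ell\epsilon'}\left[6\log\left(1+\frac{\sqrt d}{\delta'}\right)+32\log\left(\frac{6}{\eta\rho\ell\epsilon'}\right)\right]\right\rceil .$$ 2. If $g(y_{k-1}+\Delta_k)\le g(y_{k-1})-\kappa\epsilon^{3/2}\rho^{-1/2}$, let $y_k=y_{k-1}+\Delta_k$ and continue with $k+1$. 3. Otherwise start from $\Delta=\mathrm{CP}(A,b)$, repeat $\Delta\leftarrow\Delta-\eta\nabla f_{A,b}(\Delta)$ while $\|\nabla f_{A,b}(\Delta)\|>\epsilon/2$, and return $y_{k-1}+\Delta$. -/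

import Mathlib

open MeasureTheory ProbabilityTheory

noncomputable section

namespace CubicMajorization

/-! ### Second-order stationary points -/

/-- Euclidean space `ℝ^d`. -/
abbrev E (d : ℕ) : Type := EuclideanSpace ℝ (Fin d)

variable {d : ℕ}

/-- The Hessian of `g` at `y`, as a continuous linear map `v ↦ ∇²g(y) v`. -/
def hessian (g : E d → ℝ) (y : E d) : E d →L[ℝ] E d := fderiv ℝ (gradient g) y

/-- `g` is twice continuously differentiable, bounded below by `glb`, has `β`-Lipschitz gradient
and `2ρ`-Lipschitz Hessian (in the `ℓ²`-operator norm). -/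
structure IsAdmissible (g : E d → ℝ) (glb β ρ : ℝ) : Prop where
  contDiff : ContDiff ℝ 2 g
  lower_bound : ∀ y, glb ≤ g y
  smooth : ∀ y y', ‖gradient g y - gradient g y'‖ ≤ β * ‖y - y'‖
  hessian_lipschitz : ∀ y y', ‖hessian g y - hessian g y'‖ ≤ 2 * ρ * ‖y - y'‖

/-- `y` is an `ε`-second-order stationary point of `g`: `‖∇g(y)‖ ≤ ε` and
`∇²g(y) ⪰ -√(ρε) I` in the Loewner order. -/
def IsSecondOrderStationary (g : E d → ℝ) (ρ ε : ℝ) (y : E d) : Prop :=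
  ‖gradient g y‖ ≤ ε ∧ -(Real.sqrt (ρ * ε) • ContinuousLinearMap.id ℝ (E d)) ≤ hessian g y

/-! ### Computations that count oracle queries -/

/-- A value together with the number of oracle queries spent on computing it. -/
structure Counted (α : Type) : Type where
  val : α
  cost : ℕ

instance : Monad Counted where
  pure a := ⟨a, 0⟩
  bind m f := ⟨(f m.val).val, m.cost + (f m.val).cost⟩

/-- One oracle query with answer `a`. -/
def query {α : Type} (a : α) : Counted α := ⟨a, 1⟩

/-- Gradient oracle of `g`. -/
def gradOracle (g : E d → ℝ) (y : E d) : Counted (E d) := query (gradient g y)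

/-- Hessian-vector product oracle of `g`. -/
def hvpOracle (g : E d → ℝ) (y v : E d) : Counted (E d) := query (hessian g y v)

/-! ### The subproblem solvers

The matrix `A` is given to them only through an oracle `v ↦ A v`. The model is
`f(x) = (1/2) xᵀ A x + bᵀ x + (ρ/3) ‖x‖³`. -/

/-- The value `f(x)` of the cubic model. -/
def modelValue (A : E d → Counted (E d)) (b : E d) (ρ : ℝ) (x : E d) : Counted ℝ := do
  let Ax ← A x
  return 1 / 2 * inner ℝ x Ax + inner ℝ b x + ρ / 3 * ‖x‖ ^ 3

/-- The gradient `∇f(x) = A x + b + ρ ‖x‖ x` of the cubic model. -/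
def modelGrad (A : E d → Counted (E d)) (b : E d) (ρ : ℝ) (x : E d) : Counted (E d) := do
  let Ax ← A x
  return Ax + b + (ρ * ‖x‖) • x

/-- The Cauchy point `-R_c b / ‖b‖` (which is `0` if `b = 0`). -/
def cauchyPoint (A : E d → Counted (E d)) (b : E d) (ρ : ℝ) : Counted (E d) := do
  let Ab ← A b
  let r : ℝ := inner ℝ b Ab / (2 * ρ * ‖b‖ ^ 2)
  let Rc : ℝ := -r + Real.sqrt (r ^ 2 + ‖b‖ / ρ)
  return -((Rc / ‖b‖) • b)

/-- At most `n` gradient steps for the model with linear term `b'`, stopped after the first step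
that brings the model with linear term `b` to the value `thr` or below. -/
def solveLoop (A : E d → Counted (E d)) (b b' : E d) (ρ η thr : ℝ) : ℕ → E d → Counted (E d)
  | 0, x => return x
  | n + 1, x => do
    let G ← modelGrad A b' ρ x
    let x' := x - η • G
    let v ← modelValue A b ρ x'
    if v ≤ thr then return x' else solveLoop A b b' ρ η thr n x'

/-- The number `T` of gradient steps allowed in a call of `solveSubproblem`, rounded up. -/
def maxSteps (d : ℕ) (ρ η slb ε' δ : ℝ) : ℕ :=
  ⌈240 / (η * ρ * slb * ε') *
    (6 * Real.log (1 + Real.sqrt d / δ) + 32 * Real.log (6 / (η * ρ * slb * ε')))⌉₊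

/-- The Hessian-free subproblem solver: return the Cauchy point if it is good enough, otherwise
run gradient descent on the model whose linear term is perturbed by `σ q`. Here `q` is the sample
from the unit sphere drawn in this call. -/
def solveSubproblem (A : E d → Counted (E d)) (b : E d) (β ρ η slb ε' δ : ℝ) (q : E d) :
    Counted (E d) := do
  let thr : ℝ := -((1 - ε') * ρ * slb ^ 3 / 6)
  let x₀ ← cauchyPoint A b ρ
  let v ← modelValue A b ρ x₀
  if v ≤ thr then
    return x₀
  else
    let σ : ℝ := ρ ^ 2 * slb ^ 3 * ε' / (144 * (β + 2 * ρ * slb))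
    let b' := b + σ • q
    let x₀' ← cauchyPoint A b' ρ
    solveLoop A b b' ρ η thr (maxSteps d ρ η slb ε' δ) x₀'

/-- The loop `while ‖∇f(Δ)‖ > εg do Δ ← Δ - η ∇f(Δ)`, cut off (result `none`) when the loop
condition has been tested `n` times without the loop having ended. -/
def finalLoop (A : E d → Counted (E d)) (b : E d) (ρ η εg : ℝ) :
    ℕ → E d → Counted (Option (E d))
  | 0, _ => return none
  | n + 1, Δ => do
    let G ← modelGrad A b ρ Δ
    if εg < ‖G‖ then finalLoop A b ρ η εg n (Δ - η • G) else return some Δ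

/-- The final subproblem solver: gradient descent on the model from its Cauchy point, until the
gradient of the model has norm at most `εg`; cut off as `finalLoop`. -/
def solveFinalSubproblem (A : E d → Counted (E d)) (b : E d) (ρ η εg : ℝ) (n : ℕ) :
    Counted (Option (E d)) := do
  let Δ ← cauchyPoint A b ρ
  finalLoop A b ρ η εg n Δ

/-! ### The majorization method -/

/-- The progress constant. -/
def Kprog : ℝ := 1 / 324

/-- `K_max = ⌈(g(y₀) - glb) √ρ / (K_prog ε^{3/2})⌉`. -/
def Kmax (g : E d → ℝ) (glb ρ ε : ℝ) (y₀ : E d) : ℕ :=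
  ⌈(g y₀ - glb) * Real.sqrt ρ / (Kprog * ε ^ (3 / 2 : ℝ))⌉₊

/-- The main loop, entered at the iterate `y` with `k` iterations completed. It is cut off (result
`none`) after `n` iterations, and `m` is the cut-off of the final subproblem solver. The sample
that iteration `k` uses, if it needs one, is `q k`. -/
def majorizationLoop (g : E d → ℝ) (β ρ ε δ' : ℝ) (q : ℕ → E d) (m : ℕ) :
    ℕ → ℕ → E d → Counted (Option (E d))
  | 0, _, _ => return none
  | n + 1, k, y => do
    let η : ℝ := 1 / (10 * β)
    let b ← gradOracle g y
    let Δ ← solveSubproblem (hvpOracle g y) b β ρ η (Real.sqrt (ε / (9 * ρ))) (1 / 2) δ' (q k)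
    if g (y + Δ) ≤ g y - Kprog * ε ^ (3 / 2 : ℝ) * ρ ^ (-(1 / 2) : ℝ) then
      majorizationLoop g β ρ ε δ' q m n (k + 1) (y + Δ)
    else
      let r ← solveFinalSubproblem (hvpOracle g y) b ρ η (ε / 2) m
      return r.map fun Δ' => y + Δ'

/-- The majorization method, run with target accuracy `ε` and confidence level `δ` from `y₀` with
the random samples `q`, halts and returns `y`, having made `N` gradient and Hessian-vector product
evaluations in total. -/
def Returns (g : E d → ℝ) (glb β ρ ε δ : ℝ) (y₀ : E d) (q : ℕ → E d) (y : E d) (N : ℕ) : Prop :=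
  ∃ n m : ℕ,
    majorizationLoop g β ρ ε (δ / Kmax g glb ρ ε y₀) q m n 0 y₀ = ⟨some y, N⟩

/-! The cut-offs only serve to define the loops by recursion: the outcome is unique. -/

theorem Counted.eq_of_val_cost {α : Type} {a b : Counted α} (h : a.val = b.val)
    (h' : a.cost = b.cost) : a = b := by
  cases a; cases b; simp_all

theorem finalLoop_mono (A : E d → Counted (E d)) (b : E d) (ρ η εg : ℝ) (n : ℕ) :
    ∀ (Δ y : E d) (N m : ℕ), n ≤ m → finalLoop A b ρ η εg n Δ = ⟨some y, N⟩ →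
      finalLoop A b ρ η εg m Δ = ⟨some y, N⟩ := by
  induction n with
  | zero => intro Δ y N m _ h; simp [finalLoop, pure] at h
  | succ n ih =>
    intro Δ y N m hm h
    obtain ⟨m, rfl⟩ : ∃ m', m = m' + 1 := ⟨m - 1, by omega⟩
    simp only [finalLoop, bind] at h ⊢
    split_ifs at h ⊢ with hc
    · injection h with h1 h2
      rw [ih _ y _ m (by omega) (Counted.eq_of_val_cost h1 rfl)]
      simpa using h2
    · exact h

theorem majorizationLoop_mono (g : E d → ℝ) (β ρ ε δ' : ℝ) (q : ℕ → E d) (n : ℕ) :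
    ∀ (m n' m' k : ℕ) (x y : E d) (N : ℕ), n ≤ n' → m ≤ m' →
      majorizationLoop g β ρ ε δ' q m n k x = ⟨some y, N⟩ →
      majorizationLoop g β ρ ε δ' q m' n' k x = ⟨some y, N⟩ := by
  induction n with
  | zero => intro m n' m' k x y N _ _ h; simp [majorizationLoop, pure] at h
  | succ n ih =>
    intro m n' m' k x y N hn hm h
    obtain ⟨n', rfl⟩ : ∃ a, n' = a + 1 := ⟨n' - 1, by omega⟩
    simp only [majorizationLoop, bind] at h ⊢
    split_ifs at h ⊢ with hc
    · injection h with h1 h2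
      rw [ih m n' m' (k + 1) _ y _ (by omega) hm (Counted.eq_of_val_cost h1 rfl)]
      simpa using h2
    · injection h with h1 h2
      simp only [pure, Option.map_eq_some_iff] at h1
      obtain ⟨Δ', h1, h3⟩ := h1
      simp only [solveFinalSubproblem, bind] at h1 h2 ⊢
      rw [finalLoop_mono _ _ _ _ _ m _ Δ' _ m' hm (Counted.eq_of_val_cost h1 rfl)]
      simp only [pure, Option.map_some, h3]
      simpa [pure] using h2

theorem Returns.unique {g : E d → ℝ} {glb β ρ ε δ : ℝ} {y₀ : E d} {q : ℕ → E d} {y y' : E d}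
    {N N' : ℕ} (h : Returns g glb β ρ ε δ y₀ q y N) (h' : Returns g glb β ρ ε δ y₀ q y' N') :
    y = y' ∧ N = N' := by
  obtain ⟨n, m, h⟩ := h
  obtain ⟨n', m', h'⟩ := h'
  have e := majorizationLoop_mono g β ρ ε _ q n m _ _ 0 y₀ y N (le_max_left n n')
    (le_max_left m m') h
  rw [majorizationLoop_mono g β ρ ε _ q n' m' _ _ 0 y₀ y' N' (le_max_right n n')
    (le_max_right m m') h'] at e
  simp only [Counted.mk.injEq, Option.some.injEq] at e
  exact ⟨e.1.symm, e.2.symm⟩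

/-- The uniform distribution on the unit sphere of `ℝ^d`: normalized surface measure. -/
def uniformSphere (d : ℕ) : Measure (Metric.sphere (0 : E d) 1) :=
  ((volume : Measure (E d)).toSphere Set.univ)⁻¹ • (volume : Measure (E d)).toSphere

end CubicMajorization

end

/-! Write `ε = 9ρl²`. The cubic model at `y` majorizes `g(y + ·) - g(y)`, and every accepted step
lowers `g` by at least `ρl³/12`, so at most `Kmax` steps are accepted. The argument is a dichotomy
at an iterate: does the model take a value `≤ -ρl³/6` in the ball of radius `l`?

If not, then `A ⪰ -ρl` (`lower_bound_of_forall_cubic`), gradient descent never leaves the ball, and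
weak convexity brings the gradient below `ε/2` in `O(β/(ρl))` steps (`Descends.exists_small_grad`).
The point reached is second-order stationary for `g` (`isSecondOrderStationary_of_small`).

If so, the solver should reach a value `≤ -ρl³/12`. In an eigenbasis of `A` the iterates are `x_i =
-b_i z_i`, and coordinate `i` grows when `v_i = 1/z_i - λ_i - ρ‖x‖` is positive. The invariant
`Aligned` says that if `v_j > 0`, then `v_i ≥ v_j` for every smaller eigenvalue `λ_i`. This
preserves `⟨x, ∇f(x)⟩ ≤ 0`, which keeps the norm nondecreasing and gives `f(x) ≤ -ρ‖x‖³/6`. While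
`λ_min + ρ‖x‖ < -ρl/60`, the bottom coordinate grows geometrically
(`exists_le_eigenvalue_add_norm`). This cannot last, since a norm `≥ l` already means a low value.
Once it ends, the model stays almost convex along the trajectory because the norm is monotone, and
`Descends.gap_le` finishes (`exists_cubic_le`). A logarithmic growth time needs `b + σq` to have a
component along the bottom eigenvector. This is anticoncentration on the sphere
(`uniformSphere_anticoncentration`) for `d ≥ 2`; for `d = 1` the Cauchy point is already optimal
unless `b = 0`.

The iterates `chain`, defined as if every step were accepted, depend only on past draws. Hence a
union bound over `K = Kmax` calls, each failing with probability at most `δ/K`, applies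
(`measure_exists_mem_le`). Outside the failure event the first rejected step occurs at a point
without a low value (`exists_returns`). -/

noncomputable section

namespace CubicMajorization

variable {d : ℕ}

/-! ### The cubic model and its gradient -/

/-- The cubic model `(1/2) xᵀ A x + bᵀ x + (ρ/3) ‖x‖³`. -/
def cubic (A : E d →L[ℝ] E d) (b : E d) (ρ : ℝ) (x : E d) : ℝ :=
  1 / 2 * inner ℝ x (A x) + inner ℝ b x + ρ / 3 * ‖x‖ ^ 3

/-- The gradient of the cubic model. -/
def cubicGrad (A : E d →L[ℝ] E d) (b : E d) (ρ : ℝ) (x : E d) : E d :=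
  A x + b + (ρ * ‖x‖) • x

/-- One gradient step on the cubic model. -/
def gdStep (A : E d →L[ℝ] E d) (b : E d) (ρ η : ℝ) (x : E d) : E d :=
  x - η • cubicGrad A b ρ x

/-- The length of the Cauchy point. -/
def cauchyRadius (A : E d →L[ℝ] E d) (b : E d) (ρ : ℝ) : ℝ :=
  -(inner ℝ b (A b) / (2 * ρ * ‖b‖ ^ 2)) +
    Real.sqrt ((inner ℝ b (A b) / (2 * ρ * ‖b‖ ^ 2)) ^ 2 + ‖b‖ / ρ)

/-- The Cauchy point. -/
def cauchyPt (A : E d →L[ℝ] E d) (b : E d) (ρ : ℝ) : E d :=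
  -((cauchyRadius A b ρ / ‖b‖) • b)

/-- With the curvature frozen at `A + ρ‖x‖`, the remainder is explicit and nonnegative for `ρ ≥ 0`.
A lower bound on `A + ρ‖x‖` at the single point `x` thus gives weak convexity against every `u`. The
same identity yields the descent estimate. -/
theorem cubic_sub {A : E d →L[ℝ] E d} (hA : ∀ x y, inner ℝ (A x) y = inner ℝ x (A y))
    (b : E d) (ρ : ℝ) (x u : E d) :
    cubic A b ρ u - cubic A b ρ x = inner ℝ (cubicGrad A b ρ x) (u - x)
      + 1 / 2 * (inner ℝ (u - x) (A (u - x)) + ρ * ‖x‖ * ‖u - x‖ ^ 2)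
      + ρ / 6 * (‖u‖ - ‖x‖) ^ 2 * (2 * ‖u‖ + ‖x‖) := by
  have h1 : ‖u - x‖ ^ 2 = ‖u‖ ^ 2 - 2 * inner ℝ u x + ‖x‖ ^ 2 := norm_sub_sq_real u x
  have h2 := hA x u
  have h3 := real_inner_comm u (A x)
  have h4 := real_inner_comm (A x) x
  rw [h1]
  simp only [cubic, cubicGrad, inner_add_left, inner_sub_right, inner_sub_left, map_sub,
    real_inner_smul_left, real_inner_self_eq_norm_sq]
  rw [real_inner_comm u x]
  linear_combination -h4 - 1 / 2 * (h3 + h2)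

theorem abs_inner_apply_le {A : E d →L[ℝ] E d} {β : ℝ} (hA : ‖A‖ ≤ β) (x : E d) :
    |inner ℝ x (A x)| ≤ β * ‖x‖ ^ 2 := by
  have h1 := abs_real_inner_le_norm x (A x)
  have h2 := A.le_of_opNorm_le hA x
  nlinarith [norm_nonneg x]

theorem cubic_add_left (A : E d →L[ℝ] E d) (b c : E d) (ρ : ℝ) (x : E d) :
    cubic A (b + c) ρ x = cubic A b ρ x + inner ℝ c x := by
  simp only [cubic, inner_add_left]; ring

theorem inner_cubicGrad (A : E d →L[ℝ] E d) (b : E d) (ρ : ℝ) (x : E d) :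
    inner ℝ x (cubicGrad A b ρ x) = inner ℝ x (A x) + inner ℝ b x + ρ * ‖x‖ ^ 3 := by
  simp only [cubicGrad, inner_add_right, real_inner_smul_right, real_inner_self_eq_norm_sq]
  rw [real_inner_comm b x]; ring

/-- The model equals `⟨x, ∇f(x)⟩/2 + ⟨b, x⟩/2 - ρ‖x‖³/6`. -/
theorem cubic_le_of_inner_nonpos {A : E d →L[ℝ] E d} {b : E d} {ρ : ℝ} {x : E d}
    (h : inner ℝ x (cubicGrad A b ρ x) ≤ 0) (hb : inner ℝ b x ≤ 0) :
    cubic A b ρ x ≤ -(ρ * ‖x‖ ^ 3 / 6) := by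
  rw [inner_cubicGrad] at h
  simp only [cubic]
  linarith

/-- A point at which the model decreases along its ray and that lies outside the ball of radius
`l` can be shrunk to a point of that ball with a low model value. -/
theorem exists_le_of_norm_ge {A : E d →L[ℝ] E d} {b : E d} {ρ l : ℝ} {x : E d} (hρ : 0 < ρ)
    (hl : 0 < l) (h : inner ℝ x (cubicGrad A b ρ x) ≤ 0) (hb : inner ℝ b x ≤ 0) (hx : l ≤ ‖x‖) :
    ∃ u, ‖u‖ ≤ l ∧ cubic A b ρ u ≤ -(ρ * l ^ 3 / 6) := by
  have hx0 : 0 < ‖x‖ := hl.trans_le hx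
  have hn : ‖(l / ‖x‖) • x‖ = l := by
    rw [norm_smul, Real.norm_of_nonneg (by positivity)]; field_simp
  refine ⟨(l / ‖x‖) • x, hn.le, ?_⟩
  rw [inner_cubicGrad] at h
  simp only [cubic, hn, map_smul, real_inner_smul_left, real_inner_smul_right]
  set s := l / ‖x‖ with hs
  have hs0 : 0 < s := by positivity
  have hs1 : s ≤ 1 := (div_le_one hx0).2 hx
  have hl' : l = s * ‖x‖ := by rw [hs]; field_simp
  rw [hl']
  -- Bounding the curvature by `h` leaves `⟨b, x⟩` with coefficient `s(1 - s/2) ≥ 0`, and a cubic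
  -- surplus of `ρ‖x‖³ s²(1 - s)/2`.
  have e1 : s * (s * inner ℝ x (A x)) ≤ s * s * (-inner ℝ b x - ρ * ‖x‖ ^ 3) := by
    nlinarith [mul_pos hs0 hs0]
  have e2 : s * (1 - s / 2) * inner ℝ b x ≤ 0 :=
    mul_nonpos_of_nonneg_of_nonpos (mul_nonneg hs0.le (by linarith)) hb
  have e3 : 0 ≤ ρ * ‖x‖ ^ 3 * (s ^ 2 * (1 - s)) :=
    mul_nonneg (by positivity) (mul_nonneg (by positivity) (by linarith))
  nlinarith

/-- Of the two points of norm `l` on the line of `v`, take one with `⟨b, ·⟩ ≤ 0`. A curvature below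
`-ρl` there would make the model lower than `-ρl³/2 + ρl³/3`. -/
theorem lower_bound_of_forall_cubic {A : E d →L[ℝ] E d} {b : E d} {ρ l : ℝ}
    (hl : 0 < l) (h : ∀ u, ‖u‖ ≤ l → -(ρ * l ^ 3 / 6) < cubic A b ρ u) (v : E d) :
    -(ρ * l) * ‖v‖ ^ 2 ≤ inner ℝ v (A v) := by
  rcases eq_or_ne v 0 with rfl | hv
  · simp
  have hv0 : 0 < ‖v‖ := norm_pos_iff.2 hv
  wlog hb : inner ℝ b v ≤ 0 generalizing v with H
  · simpa using H (-v) (by simpa using hv) (by simpa using hv0) (by simp at hb ⊢; linarith)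
  have hn : ‖(l / ‖v‖) • v‖ = l := by
    rw [norm_smul, Real.norm_of_nonneg (by positivity)]; field_simp
  have key := h ((l / ‖v‖) • v) hn.le
  simp only [cubic, hn, map_smul, real_inner_smul_left, real_inner_smul_right] at key
  have e1 : l / ‖v‖ * inner ℝ b v ≤ 0 := mul_nonpos_of_nonneg_of_nonpos (by positivity) hb
  have e2 : -(ρ * l ^ 3) ≤ l / ‖v‖ * (l / ‖v‖ * inner ℝ v (A v)) := by linarith
  have e3 : l / ‖v‖ * (l / ‖v‖ * inner ℝ v (A v)) = l ^ 2 * inner ℝ v (A v) / ‖v‖ ^ 2 := by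
    field_simp
  rw [e3, le_div_iff₀ (by positivity)] at e2
  have : l ^ 2 * (-(ρ * l) * ‖v‖ ^ 2) ≤ l ^ 2 * inner ℝ v (A v) := by linarith
  exact le_of_mul_le_mul_left this (by positivity)

/-! ### The Cauchy point -/

theorem cauchyRadius_pos {A : E d →L[ℝ] E d} {b : E d} {ρ : ℝ} (hρ : 0 < ρ) (hb : b ≠ 0) :
    0 < cauchyRadius A b ρ := by
  have hb0 : 0 < ‖b‖ := norm_pos_iff.2 hb
  unfold cauchyRadius
  set r := inner ℝ b (A b) / (2 * ρ * ‖b‖ ^ 2)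
  have : |r| < √(r ^ 2 + ‖b‖ / ρ) := by
    rw [← Real.sqrt_sq_eq_abs]
    exact Real.sqrt_lt_sqrt (sq_nonneg _) (lt_add_of_pos_right _ (by positivity))
  linarith [le_abs_self r]

/-- The radius is the positive root of the stationarity equation of the model along the ray of `-b`.
-/
theorem cauchyRadius_eq {A : E d →L[ℝ] E d} {b : E d} {ρ : ℝ} (hρ : 0 < ρ) (hb : b ≠ 0) :
    inner ℝ b (A b) / ‖b‖ ^ 2 * cauchyRadius A b ρ + ρ * cauchyRadius A b ρ ^ 2 = ‖b‖ := by
  have hb0 : 0 < ‖b‖ := norm_pos_iff.2 hb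
  have e : inner ℝ b (A b) / ‖b‖ ^ 2 = 2 * ρ * (inner ℝ b (A b) / (2 * ρ * ‖b‖ ^ 2)) := by
    field_simp
  rw [e]
  unfold cauchyRadius
  set r := inner ℝ b (A b) / (2 * ρ * ‖b‖ ^ 2)
  have h := Real.sq_sqrt (show 0 ≤ r ^ 2 + ‖b‖ / ρ by positivity)
  set S := √(r ^ 2 + ‖b‖ / ρ)
  have : ρ * (‖b‖ / ρ) = ‖b‖ := by field_simp
  linear_combination ρ * h + this

theorem norm_cauchyPt {A : E d →L[ℝ] E d} {b : E d} {ρ : ℝ} (hρ : 0 < ρ) (hb : b ≠ 0) :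
    ‖cauchyPt A b ρ‖ = cauchyRadius A b ρ := by
  have hb0 : 0 < ‖b‖ := norm_pos_iff.2 hb
  have := cauchyRadius_pos (A := A) hρ hb
  rw [cauchyPt, norm_neg, norm_smul, Real.norm_of_nonneg (by positivity)]
  field_simp

theorem inner_left_cauchyPt {A : E d →L[ℝ] E d} {b : E d} {ρ : ℝ} (hb : b ≠ 0) :
    inner ℝ b (cauchyPt A b ρ) = -(cauchyRadius A b ρ * ‖b‖) := by
  have hb0 : 0 < ‖b‖ := norm_pos_iff.2 hb
  simp only [cauchyPt, inner_neg_right, real_inner_smul_right, real_inner_self_eq_norm_sq]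
  field_simp

@[simp] theorem cauchyPt_zero (A : E d →L[ℝ] E d) (ρ : ℝ) : cauchyPt A 0 ρ = 0 := by
  simp [cauchyPt]

theorem inner_cauchyPt_le {A : E d →L[ℝ] E d} {b : E d} {ρ : ℝ} (hρ : 0 < ρ) :
    inner ℝ b (cauchyPt A b ρ) ≤ 0 := by
  rcases eq_or_ne b 0 with rfl | hb
  · simp
  · rw [inner_left_cauchyPt hb]
    have := cauchyRadius_pos (A := A) hρ hb
    have := norm_nonneg b
    simp only [Left.neg_nonpos_iff]; positivity

theorem inner_cauchyPt_cubicGrad {A : E d →L[ℝ] E d} {b : E d} {ρ : ℝ} (hρ : 0 < ρ) :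
    inner ℝ (cauchyPt A b ρ) (cubicGrad A b ρ (cauchyPt A b ρ)) = 0 := by
  rcases eq_or_ne b 0 with rfl | hb
  · simp
  have hb0 : 0 < ‖b‖ := norm_pos_iff.2 hb
  rw [inner_cubicGrad, inner_left_cauchyPt hb, norm_cauchyPt hρ hb]
  have h := cauchyRadius_eq (A := A) hρ hb
  have e : inner ℝ (cauchyPt A b ρ) (A (cauchyPt A b ρ)) =
      cauchyRadius A b ρ ^ 2 * (inner ℝ b (A b) / ‖b‖ ^ 2) := by
    simp only [cauchyPt, map_neg, map_smul, inner_neg_left, inner_neg_right, real_inner_smul_left,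
      real_inner_smul_right]
    field_simp
  rw [e]
  linear_combination cauchyRadius A b ρ * h

/-- The radius equation expresses `‖b‖` through the radius, so a short Cauchy step forces a small
linear term. This is the source of the condition `Regime.linear_le`. -/
theorem norm_le_of_norm_cauchyPt_le {A : E d →L[ℝ] E d} {b : E d} {β ρ l : ℝ} (hρ : 0 < ρ)
    (hβ : 0 < β) (hA : ‖A‖ ≤ β) (hl : 0 < l) (h : ‖cauchyPt A b ρ‖ ≤ l) :
    ‖b‖ ≤ (β + ρ * l) * l := by
  rcases eq_or_ne b 0 with rfl | hb
  · simp; positivity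
  have hb0 : 0 < ‖b‖ := norm_pos_iff.2 hb
  rw [norm_cauchyPt hρ hb] at h
  have h0 := cauchyRadius_pos (A := A) hρ hb
  rw [← cauchyRadius_eq (A := A) hρ hb]
  have h1 : inner ℝ b (A b) / ‖b‖ ^ 2 ≤ β := by
    rw [div_le_iff₀ (by positivity)]
    exact (le_abs_self _).trans (abs_inner_apply_le hA b)
  calc _ ≤ β * l + ρ * l ^ 2 := by gcongr
    _ = _ := by ring

section GradientStep

/-! ### Gradient descent on the cubic model -/

/-- The parameters for which gradient descent with step size `1 / (10 β)` behaves well. -/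
structure Regime (A : E d →L[ℝ] E d) (b : E d) (β ρ : ℝ) : Prop where
  β_pos : 0 < β
  ρ_pos : 0 < ρ
  symm : ∀ x y, inner ℝ (A x) y = inner ℝ x (A y)
  norm_le : ‖A‖ ≤ β
  linear_le : ρ * ‖b‖ ≤ β ^ 2 / 2

/-- An orthonormal basis of eigenvectors of `A`. -/
structure Diagonalizes (A : E d →L[ℝ] E d) (e : OrthonormalBasis (Fin d) ℝ (E d))
    (lam : Fin d → ℝ) : Prop where
  apply_eq : ∀ i x, inner ℝ (e i) (A x) = lam i * inner ℝ (e i) x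

theorem exists_diagonalizes {A : E d →L[ℝ] E d}
    (hA : ∀ x y, inner ℝ (A x) y = inner ℝ x (A y)) : ∃ e lam, Diagonalizes A e lam := by
  have hs : (A : E d →ₗ[ℝ] E d).IsSymmetric := fun x y => hA x y
  have hn : Module.finrank ℝ (E d) = d := by simp
  refine ⟨hs.eigenvectorBasis hn, hs.eigenvalues hn, ⟨fun i x => ?_⟩⟩
  rw [← hA]
  have := hs.apply_eigenvectorBasis hn i
  simp only [ContinuousLinearMap.coe_coe] at this
  rw [this, real_inner_smul_left]
  rfl

variable {A : E d →L[ℝ] E d} {b : E d} {β ρ : ℝ} {e : OrthonormalBasis (Fin d) ℝ (E d)}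
  {lam : Fin d → ℝ}

theorem inner_eq_sum (e : OrthonormalBasis (Fin d) ℝ (E d)) (x y : E d) :
    inner ℝ x y = ∑ i, inner ℝ (e i) x * inner ℝ (e i) y := by
  rw [← e.sum_inner_mul_inner x y]
  exact Finset.sum_congr rfl fun i _ => by rw [real_inner_comm]

theorem Diagonalizes.eigenvalue_le (h : Diagonalizes A e lam) (hA : ‖A‖ ≤ β) (i : Fin d) :
    lam i ≤ β := by
  have h1 := h.apply_eq i (e i)
  have h2 := (le_abs_self _).trans (abs_inner_apply_le hA (e i))
  rw [h1] at h2
  simpa [real_inner_self_eq_norm_sq] using h2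

theorem Diagonalizes.mul_norm_sq_le (h : Diagonalizes A e lam) {c : ℝ} (hc : ∀ i, c ≤ lam i)
    (x : E d) : c * ‖x‖ ^ 2 ≤ inner ℝ x (A x) := by
  rw [inner_eq_sum e x (A x), ← real_inner_self_eq_norm_sq, inner_eq_sum e x x, Finset.mul_sum]
  refine Finset.sum_le_sum fun i _ => ?_
  rw [h.apply_eq]
  nlinarith [mul_self_nonneg (inner ℝ (e i) x), hc i]

/-- The invariant of gradient descent started at the Cauchy point. In the eigenbasis of `A`, the
iterate is `x_i = -b_i z_i`. -/
structure Aligned (A : E d →L[ℝ] E d) (b : E d) (ρ : ℝ) (e : OrthonormalBasis (Fin d) ℝ (E d))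
    (lam : Fin d → ℝ) (x : E d) (z : Fin d → ℝ) : Prop where
  coord : ∀ i, inner ℝ (e i) x = -(inner ℝ (e i) b * z i)
  pos : ∀ i, 0 < z i
  order : ∀ i j, lam i ≤ lam j → 0 < 1 / z j - (lam j + ρ * ‖x‖) →
    1 / z j - lam j ≤ 1 / z i - lam i
  inner_nonpos : inner ℝ x (cubicGrad A b ρ x) ≤ 0

variable {x : E d} {z : Fin d → ℝ}

theorem Aligned.inner_left_nonpos (h : Aligned A b ρ e lam x z) : inner ℝ b x ≤ 0 := by
  rw [inner_eq_sum e b x]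
  refine Finset.sum_nonpos fun i _ => ?_
  rw [h.coord]
  nlinarith [mul_nonneg (mul_self_nonneg (inner ℝ (e i) b)) (h.pos i).le]

theorem Aligned.cubic_le (h : Aligned A b ρ e lam x z) :
    cubic A b ρ x ≤ -(ρ * ‖x‖ ^ 3 / 6) :=
  cubic_le_of_inner_nonpos h.inner_nonpos h.inner_left_nonpos

/-- The hypothesis gives `t² ≤ βt + β²/2` for `t = ρ‖x‖`, hence `t ≤ (1 + √3)β/2 < 3β/2`. -/
theorem Regime.norm_le_of_inner_nonpos (hR : Regime A b β ρ)
    (h : inner ℝ x (cubicGrad A b ρ x) ≤ 0) : ρ * ‖x‖ ≤ 3 / 2 * β := by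
  obtain ⟨hβ, hρ, -, hA, hb⟩ := hR
  rw [inner_cubicGrad] at h
  have h1 := neg_le_of_abs_le (abs_inner_apply_le hA x)
  have h2 := neg_le_of_abs_le (abs_real_inner_le_norm b x)
  by_contra! hc
  have hx : 0 < ‖x‖ := by
    by_contra! h0
    nlinarith [norm_nonneg x]
  have h3 : ‖x‖ * (ρ * ‖x‖ ^ 2) ≤ ‖x‖ * (β * ‖x‖ + ‖b‖) := by nlinarith
  have h4 := le_of_mul_le_mul_left h3 hx
  have h5 : (ρ * ‖x‖) ^ 2 ≤ β * (ρ * ‖x‖) + β ^ 2 / 2 := by nlinarith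
  nlinarith

theorem norm_cubicGrad_le (hA : ‖A‖ ≤ β) (hρ : 0 ≤ ρ) (b x : E d) :
    ‖cubicGrad A b ρ x‖ ≤ (β + ρ * ‖x‖) * ‖x‖ + ‖b‖ := by
  have h1 := A.le_of_opNorm_le hA x
  have h2 : ‖(ρ * ‖x‖) • x‖ = ρ * ‖x‖ * ‖x‖ := by
    rw [norm_smul, Real.norm_of_nonneg (by positivity)]
  have := norm_add₃_le (a := A x) (b := b) (c := (ρ * ‖x‖) • x)
  unfold cubicGrad
  linarith

theorem Regime.norm_gdStep_le (hR : Regime A b β ρ)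
    (h : inner ℝ x (cubicGrad A b ρ x) ≤ 0) :
    ρ * ‖gdStep A b ρ (1 / (10 * β)) x‖ ≤ 2 * β := by
  have hx := hR.norm_le_of_inner_nonpos h
  obtain ⟨hβ, hρ, -, hA, hb⟩ := hR
  have h1 := norm_cubicGrad_le hA hρ.le b x
  have h2 : ‖gdStep A b ρ (1 / (10 * β)) x‖ ≤ ‖x‖ + 1 / (10 * β) * ‖cubicGrad A b ρ x‖ := by
    refine (norm_sub_le _ _).trans_eq ?_
    rw [norm_smul, Real.norm_of_nonneg (by positivity)]
  have h3 : ρ * ‖cubicGrad A b ρ x‖ ≤ 5 * β ^ 2 := by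
    have := mul_le_mul_of_nonneg_left h1 hρ.le
    nlinarith [norm_nonneg x, mul_nonneg hρ.le (norm_nonneg x)]
  calc _ ≤ ρ * (‖x‖ + 1 / (10 * β) * ‖cubicGrad A b ρ x‖) := by gcongr
    _ = ρ * ‖x‖ + 1 / (10 * β) * (ρ * ‖cubicGrad A b ρ x‖) := by ring
    _ ≤ 3 / 2 * β + 1 / (10 * β) * (5 * β ^ 2) := by gcongr
    _ = _ := by field_simp; norm_num

theorem Regime.norm_le_norm_gdStep (hR : Regime A b β ρ)
    (h : inner ℝ x (cubicGrad A b ρ x) ≤ 0) :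
    ‖x‖ ≤ ‖gdStep A b ρ (1 / (10 * β)) x‖ := by
  have hβ := hR.β_pos
  refine (sq_le_sq₀ (norm_nonneg _) (norm_nonneg _)).1 ?_
  rw [gdStep, norm_sub_sq_real, real_inner_smul_right]
  have : 0 ≤ 1 / (10 * β) := by positivity
  nlinarith [sq_nonneg ‖(1 / (10 * β)) • cubicGrad A b ρ x‖]

/-- The sufficient decrease of a gradient step. -/
theorem Regime.cubic_gdStep_le (hR : Regime A b β ρ)
    (h : inner ℝ x (cubicGrad A b ρ x) ≤ 0) :
    cubic A b ρ (gdStep A b ρ (1 / (10 * β)) x) ≤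
      cubic A b ρ x - 1 / (10 * β) / 2 * ‖cubicGrad A b ρ x‖ ^ 2 := by
  have hx := hR.norm_le_of_inner_nonpos h
  have hx' := hR.norm_gdStep_le h
  have hβ := hR.β_pos
  have hρ := hR.ρ_pos
  have key := cubic_sub hR.symm b ρ x (gdStep A b ρ (1 / (10 * β)) x)
  set x' := gdStep A b ρ (1 / (10 * β)) x with hxd
  set G := cubicGrad A b ρ x
  have e1 : x' - x = -((1 / (10 * β)) • G) := by rw [hxd, gdStep]; abel
  have h1 := (le_abs_self _).trans (abs_inner_apply_le hR.norm_le (x' - x))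
  have h2 : (‖x'‖ - ‖x‖) ^ 2 ≤ ‖x' - x‖ ^ 2 := by
    rw [sq_le_sq]; exact (abs_norm_sub_norm_le _ _).trans (le_abs_self _)
  have e2 : ‖x' - x‖ ^ 2 = (1 / (10 * β)) ^ 2 * ‖G‖ ^ 2 := by
    rw [e1, norm_neg, norm_smul, Real.norm_of_nonneg (by positivity)]; ring
  have e3 : inner ℝ G (x' - x) = -(1 / (10 * β) * ‖G‖ ^ 2) := by
    rw [e1, inner_neg_right, real_inner_smul_right, real_inner_self_eq_norm_sq]
  have h3 : ρ / 6 * (‖x'‖ - ‖x‖) ^ 2 * (2 * ‖x'‖ + ‖x‖) ≤ 2 * β * ‖x' - x‖ ^ 2 := by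
    calc _ = (‖x'‖ - ‖x‖) ^ 2 * ((2 * (ρ * ‖x'‖) + ρ * ‖x‖) / 6) := by ring
      _ ≤ ‖x' - x‖ ^ 2 * (2 * β) := by gcongr; linarith
      _ = _ := by ring
  have h4 : ρ * ‖x‖ * ‖x' - x‖ ^ 2 ≤ 3 / 2 * β * ‖x' - x‖ ^ 2 := by gcongr
  have h5 : cubic A b ρ x' - cubic A b ρ x ≤
      -(1 / (10 * β) * ‖G‖ ^ 2) + 5 * β * ‖x' - x‖ ^ 2 := by
    rw [key, e3]; nlinarith [sq_nonneg ‖x' - x‖]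
  rw [e2] at h5
  have e4 : 5 * β * ((1 / (10 * β)) ^ 2 * ‖G‖ ^ 2) = 1 / (10 * β) / 2 * ‖G‖ ^ 2 := by
    field_simp; ring
  linarith

theorem Aligned.inner_grad (hD : Diagonalizes A e lam) (h : Aligned A b ρ e lam x z) (i : Fin d) :
    inner ℝ (e i) (cubicGrad A b ρ x) =
      inner ℝ (e i) b * (1 - (lam i + ρ * ‖x‖) * z i) := by
  simp only [cubicGrad, inner_add_right, real_inner_smul_right, hD.apply_eq, h.coord]
  ring

/-- The key estimate: the positive coordinates of `-x_i ∇f(x)_i` belong to the smaller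
eigenvalues. -/
theorem Aligned.inner_apply_grad (hR : Regime A b β ρ) (hD : Diagonalizes A e lam)
    (h : Aligned A b ρ e lam x z) :
    (β + ρ * ‖x‖) * inner ℝ x (cubicGrad A b ρ x) ≤
      inner ℝ x (A (cubicGrad A b ρ x)) + ρ * ‖x‖ * inner ℝ x (cubicGrad A b ρ x) := by
  -- `c i` is `-x_i ∇f(x)_i`; when positive, the gradient step enlarges the coordinate.
  set c : Fin d → ℝ := fun i => inner ℝ (e i) b ^ 2 * (z i ^ 2 * (1 / z i - (lam i + ρ * ‖x‖)))
    with hc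
  have e0 : ∀ i, inner ℝ (e i) x * inner ℝ (e i) (cubicGrad A b ρ x) = -c i := by
    intro i
    have := (h.pos i).ne'
    rw [h.inner_grad hD, h.coord, hc]
    field_simp
  have e1 : inner ℝ x (cubicGrad A b ρ x) = -∑ i, c i := by
    rw [inner_eq_sum e, ← Finset.sum_neg_distrib]
    exact Finset.sum_congr rfl fun i _ => e0 i
  have e2 : inner ℝ x (A (cubicGrad A b ρ x)) = -∑ i, lam i * c i := by
    rw [inner_eq_sum e, ← Finset.sum_neg_distrib]
    refine Finset.sum_congr rfl fun i _ => ?_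
    rw [hD.apply_eq, mul_left_comm, e0]
    ring
  have hp : 0 ≤ ∑ i, c i := by have := h.inner_nonpos; linarith
  suffices hs : ∑ i, lam i * c i ≤ β * ∑ i, c i by rw [e1, e2]; linarith
  by_cases hex : ∃ j, 0 < 1 / z j - (lam j + ρ * ‖x‖)
  -- Take the largest eigenvalue `lam j` with a growing coordinate. By `order`, coordinates that do
  -- not grow have eigenvalues at least `lam j`, so replacing each `lam i` by `lam j` can only
  -- enlarge the sum.
  · obtain ⟨j, hj, hmax⟩ := Finset.exists_max_image
      (Finset.univ.filter fun j => 0 < 1 / z j - (lam j + ρ * ‖x‖)) lam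
      (by simpa [Finset.Nonempty] using hex)
    simp only [Finset.mem_filter, Finset.mem_univ, true_and] at hj hmax
    calc ∑ i, lam i * c i ≤ ∑ i, lam j * c i := by
          refine Finset.sum_le_sum fun i _ => ?_
          have hz := sq_nonneg (z i)
          have hb := sq_nonneg (inner ℝ (e i) b)
          rcases lt_or_ge 0 (1 / z i - (lam i + ρ * ‖x‖)) with hi | hi
          · exact mul_le_mul_of_nonneg_right (hmax i hi) (by positivity)
          · refine mul_le_mul_of_nonpos_right ?_ (mul_nonpos_of_nonneg_of_nonpos hb
              (mul_nonpos_of_nonneg_of_nonpos hz hi))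
            by_contra! hlt
            have := h.order i j hlt.le hj
            linarith
      _ = lam j * ∑ i, c i := by rw [Finset.mul_sum]
      _ ≤ β * ∑ i, c i := by gcongr; exact hD.eigenvalue_le hR.norm_le j
  · push Not at hex
    have hc0 : ∀ i, c i ≤ 0 := fun i => mul_nonpos_of_nonneg_of_nonpos (sq_nonneg _)
      (mul_nonpos_of_nonneg_of_nonpos (sq_nonneg _) (hex i))
    have hz : ∀ i, c i = 0 := by
      have := le_antisymm (Finset.sum_nonpos fun i (_ : i ∈ Finset.univ) => hc0 i) hp
      intro i
      exact (Finset.sum_eq_zero_iff_of_nonpos fun i _ => hc0 i).1 this i (Finset.mem_univ i)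
    simp [hz]

/-- The new gradient is `(1 - η(A + ρ‖x‖))G + ρ(‖x'‖ - ‖x‖)x'`. Its cross term `-η⟨x, AG⟩` is what
`Aligned.inner_apply_grad` controls. With `ηβ = 1/10`, `p = ⟨x, G⟩ ≤ 0` and `q = ‖G‖²`, the bounds
add up to `(7/20)p - (11/20)ηq`. -/
theorem Aligned.inner_gdStep_nonpos (hR : Regime A b β ρ) (hD : Diagonalizes A e lam)
    (h : Aligned A b ρ e lam x z) :
    inner ℝ (gdStep A b ρ (1 / (10 * β)) x)
      (cubicGrad A b ρ (gdStep A b ρ (1 / (10 * β)) x)) ≤ 0 := by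
  have hβ := hR.β_pos
  have hρ := hR.ρ_pos
  have hx := hR.norm_le_of_inner_nonpos h.inner_nonpos
  have hx' := hR.norm_gdStep_le h.inner_nonpos
  have hmono := hR.norm_le_norm_gdStep h.inner_nonpos
  have hkey := h.inner_apply_grad hR hD
  have hp := h.inner_nonpos
  set η := 1 / (10 * β) with hη
  have hη0 : 0 < η := by positivity
  have hηβ : η * β = 1 / 10 := by rw [hη]; field_simp
  set x' := gdStep A b ρ η x with hxd
  set G := cubicGrad A b ρ x with hG
  have eg : cubicGrad A b ρ x' =
      G - η • (A G + (ρ * ‖x‖) • G) + (ρ * (‖x'‖ - ‖x‖)) • x' := by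
    have : A x' = A x - η • A G := by rw [hxd, gdStep]; simp [hG]
    have e2 : (ρ * ‖x‖) • x' = (ρ * ‖x‖) • x - η • (ρ * ‖x‖) • G := by
      rw [hxd, gdStep, smul_sub, smul_comm]
    have e3 : (ρ * (‖x'‖ - ‖x‖)) • x' = (ρ * ‖x'‖) • x' - (ρ * ‖x‖) • x' := by
      rw [← sub_smul]; congr 1; ring
    rw [e3, e2]
    conv_lhs => rw [cubicGrad, this]
    have hG' : G = A x + b + (ρ * ‖x‖) • x := rfl
    generalize A G = w
    rw [hG']
    module
  have hAG := (le_abs_self _).trans (abs_inner_apply_le hR.norm_le G)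
  have hr2 : ‖x'‖ ^ 2 - ‖x‖ ^ 2 = -(2 * η * inner ℝ x G) + η ^ 2 * ‖G‖ ^ 2 := by
    rw [hxd, gdStep, norm_sub_sq_real, real_inner_smul_right, norm_smul,
      Real.norm_of_nonneg hη0.le]
    ring
  have ei : inner ℝ x' (cubicGrad A b ρ x') = inner ℝ x G - η * ‖G‖ ^ 2
      - η * (inner ℝ x (A G) + ρ * ‖x‖ * inner ℝ x G)
      + η ^ 2 * (inner ℝ G (A G) + ρ * ‖x‖ * ‖G‖ ^ 2) + ρ * (‖x'‖ - ‖x‖) * ‖x'‖ ^ 2 := by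
    rw [eg, inner_add_right, real_inner_smul_right, real_inner_self_eq_norm_sq]
    congr 1
    rw [hxd, gdStep, ← hG]
    simp only [inner_sub_left, inner_sub_right, inner_add_right, real_inner_smul_left,
      real_inner_smul_right, real_inner_self_eq_norm_sq]
    ring
  have hlast : ρ * (‖x'‖ - ‖x‖) * ‖x'‖ ^ 2 ≤
      2 * β * (-(2 * η * inner ℝ x G) + η ^ 2 * ‖G‖ ^ 2) := by
    rw [← hr2]
    have h0 : 0 ≤ ‖x'‖ - ‖x‖ := by linarith
    calc ρ * (‖x'‖ - ‖x‖) * ‖x'‖ ^ 2 = (ρ * ‖x'‖) * ((‖x'‖ - ‖x‖) * ‖x'‖) := by ring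
      _ ≤ (2 * β) * ((‖x'‖ - ‖x‖) * (‖x'‖ + ‖x‖)) := by
        gcongr
        linarith [norm_nonneg x]
      _ = _ := by ring
  rw [ei]
  set p := inner ℝ x G
  set q := ‖G‖ ^ 2
  have hq : 0 ≤ q := sq_nonneg _
  have h1 : η * ((β + ρ * ‖x‖) * p) ≤ η * (inner ℝ x (A G) + ρ * ‖x‖ * p) := by gcongr
  have h2 : η ^ 2 * (inner ℝ G (A G) + ρ * ‖x‖ * q) ≤ η ^ 2 * (5 / 2 * β * q) := by
    gcongr; nlinarith
  have h3 : η * (ρ * ‖x‖) ≤ 3 / 20 := by nlinarith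
  have h4 : η ^ 2 * (5 / 2 * β * q) = η * (1 / 4) * q := by
    linear_combination (5 / 2 * η * q) * hηβ
  have h5 : η * ((β + ρ * ‖x‖) * p) = (1 / 10 + η * (ρ * ‖x‖)) * p := by
    linear_combination p * hηβ
  have h6 : 2 * β * (-(2 * η * p) + η ^ 2 * q) = -(4 / 10) * p + η * (2 / 10) * q := by
    linear_combination (-4 * p + 2 * η * q) * hηβ
  have h7 : (1 / 10 + η * (ρ * ‖x‖)) * p ≥ 1 / 4 * p := by nlinarith
  nlinarith [mul_nonneg hη0.le hq]

/-- A gradient step keeps the invariant. -/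
theorem Aligned.gdStep (hR : Regime A b β ρ) (hD : Diagonalizes A e lam)
    (h : Aligned A b ρ e lam x z) :
    Aligned A b ρ e lam (gdStep A b ρ (1 / (10 * β)) x)
      (fun i => (1 - 1 / (10 * β) * (lam i + ρ * ‖x‖)) * z i + 1 / (10 * β)) := by
  have hβ := hR.β_pos
  have hρ := hR.ρ_pos
  have hx := hR.norm_le_of_inner_nonpos h.inner_nonpos
  have hmono := hR.norm_le_norm_gdStep h.inner_nonpos
  have hin := h.inner_gdStep_nonpos hR hD
  set η := 1 / (10 * β) with hη
  have hη0 : 0 < η := by positivity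
  have hηβ : η * β = 1 / 10 := by rw [hη]; field_simp
  have hμ : ∀ i, 0 < 1 - η * (lam i + ρ * ‖x‖) := fun i => by
    have := hD.eigenvalue_le hR.norm_le i
    nlinarith
  have hpos : ∀ i, 0 < (1 - η * (lam i + ρ * ‖x‖)) * z i + η := fun i => by
    have := hμ i; have := h.pos i; positivity
  refine ⟨fun i => ?_, hpos, fun i j hij hj => ?_, hin⟩
  · simp only [CubicMajorization.gdStep, inner_sub_right, real_inner_smul_right, h.inner_grad hD,
      h.coord]
    ring
  · set x' := CubicMajorization.gdStep A b ρ η x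
    -- The update is `z' = z(1 + ηv)`. Since `v/(1 + ηv)` increases with `v` and `1 - η(λ + ρ‖x‖)`
    -- decreases with `λ`, the order of the offsets survives.
    have key : ∀ k, ∀ v, v = 1 / z k - (lam k + ρ * ‖x‖) → 0 < 1 + η * v ∧
        1 / ((1 - η * (lam k + ρ * ‖x‖)) * z k + η) - (lam k + ρ * ‖x‖) =
        v / (1 + η * v) * (1 - η * (lam k + ρ * ‖x‖)) := by
      intro k v hv
      have hz := h.pos k
      have hk := hpos k
      have e1 : 1 + η * v = ((1 - η * (lam k + ρ * ‖x‖)) * z k + η) / z k := by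
        rw [hv]; field_simp; ring
      refine ⟨by rw [e1]; positivity, ?_⟩
      rw [e1, hv]
      field_simp
      ring
    obtain ⟨pj, ej⟩ := key j _ rfl
    obtain ⟨pi, ei⟩ := key i _ rfl
    set vi := 1 / z i - (lam i + ρ * ‖x‖) with hvi
    set vj := 1 / z j - (lam j + ρ * ‖x‖) with hvj
    -- The norm has not dropped, so a coordinate growing at `x'` was already growing at `x`.
    have hmono' : ρ * ‖x‖ ≤ ρ * ‖x'‖ := by gcongr
    have hj' : 0 < vj / (1 + η * vj) * (1 - η * (lam j + ρ * ‖x‖)) := by rw [← ej]; linarith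
    have hvj0 : 0 < vj := by
      have := (pos_iff_pos_of_mul_pos hj').2 (hμ j)
      exact (div_pos_iff_of_pos_right pj).1 this
    have hle : vj ≤ vi := by have := h.order i j hij hvj0; linarith
    have hfrac : vj / (1 + η * vj) ≤ vi / (1 + η * vi) := by
      rw [div_le_div_iff₀ pj pi]; nlinarith
    have : vj / (1 + η * vj) * (1 - η * (lam j + ρ * ‖x‖)) ≤
        vi / (1 + η * vi) * (1 - η * (lam i + ρ * ‖x‖)) := by
      have := (hμ j).le
      gcongr
      exact (div_pos (hvj0.trans_le hle) pi).le
    rw [← ej, ← ei] at this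
    linarith

/-- The Cauchy point satisfies the invariant. -/
theorem exists_aligned_cauchyPt (e : OrthonormalBasis (Fin d) ℝ (E d)) (lam : Fin d → ℝ)
    (hρ : 0 < ρ) : ∃ z, Aligned A b ρ e lam (cauchyPt A b ρ) z := by
  have hin := (inner_cauchyPt_cubicGrad (A := A) (b := b) hρ).le
  rcases eq_or_ne b 0 with rfl | hb
  · exact ⟨fun _ => 1, fun i => by simp, fun i => one_pos, fun i j hij _ => by linarith, hin⟩
  · have hb0 : 0 < ‖b‖ := norm_pos_iff.2 hb
    have hr := cauchyRadius_pos (A := A) hρ hb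
    refine ⟨fun _ => cauchyRadius A b ρ / ‖b‖, fun i => ?_, fun i => by positivity,
      fun i j hij _ => by linarith, hin⟩
    simp only [cauchyPt, inner_neg_right, real_inner_smul_right]
    ring

end GradientStep

section Trajectory

variable {A : E d →L[ℝ] E d} {b : E d} {β ρ : ℝ} {e : OrthonormalBasis (Fin d) ℝ (E d)}
  {lam : Fin d → ℝ}

/-! ### Trajectories of gradient descent -/

/-- A gradient descent trajectory along which the norm is nondecreasing and the model has
nonpositive linear part. -/
structure Descends (A : E d →L[ℝ] E d) (b : E d) (β ρ : ℝ) (X : ℕ → E d) : Prop where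
  step : ∀ n, X (n + 1) = gdStep A b ρ (1 / (10 * β)) (X n)
  inner_nonpos : ∀ n, inner ℝ (X n) (cubicGrad A b ρ (X n)) ≤ 0
  inner_left_nonpos : ∀ n, inner ℝ b (X n) ≤ 0

/-- The gradient descent iterates from the Cauchy point. -/
def gdIter (A : E d →L[ℝ] E d) (b : E d) (β ρ : ℝ) (n : ℕ) : E d :=
  (gdStep A b ρ (1 / (10 * β)))^[n] (cauchyPt A b ρ)

theorem gdIter_succ (A : E d →L[ℝ] E d) (b : E d) (β ρ : ℝ) (n : ℕ) :
    gdIter A b β ρ (n + 1) = gdStep A b ρ (1 / (10 * β)) (gdIter A b β ρ n) :=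
  Function.iterate_succ_apply' _ _ _

theorem exists_aligned_gdIter (hR : Regime A b β ρ) (hD : Diagonalizes A e lam) :
    ∃ z : ℕ → Fin d → ℝ, (∀ n, Aligned A b ρ e lam (gdIter A b β ρ n) (z n)) ∧
      ∀ n i, z (n + 1) i =
        (1 - 1 / (10 * β) * (lam i + ρ * ‖gdIter A b β ρ n‖)) * z n i + 1 / (10 * β) := by
  obtain ⟨z₀, h₀⟩ := exists_aligned_cauchyPt (A := A) (b := b) e lam hR.ρ_pos
  let z : ℕ → Fin d → ℝ := fun n => Nat.rec z₀ (fun n zn i =>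
    (1 - 1 / (10 * β) * (lam i + ρ * ‖gdIter A b β ρ n‖)) * zn i + 1 / (10 * β)) n
  refine ⟨z, fun n => ?_, fun n i => rfl⟩
  induction n with
  | zero => exact h₀
  | succ n ih => rw [gdIter_succ]; exact ih.gdStep hR hD

theorem descends_gdIter (hR : Regime A b β ρ) : Descends A b β ρ (gdIter A b β ρ) := by
  obtain ⟨e, lam, hD⟩ := exists_diagonalizes hR.symm
  obtain ⟨z, hz, -⟩ := exists_aligned_gdIter hR hD
  exact ⟨gdIter_succ A b β ρ, fun n => (hz n).inner_nonpos, fun n => (hz n).inner_left_nonpos⟩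

variable {X : ℕ → E d}

theorem Descends.shift (h : Descends A b β ρ X) (a : ℕ) : Descends A b β ρ fun n => X (a + n) :=
  ⟨fun n => h.step (a + n), fun n => h.inner_nonpos (a + n), fun n => h.inner_left_nonpos (a + n)⟩

theorem Descends.norm_mono (h : Descends A b β ρ X) (hR : Regime A b β ρ) :
    Monotone fun n => ‖X n‖ :=
  monotone_nat_of_le_succ fun n => by
    rw [h.step]; exact hR.norm_le_norm_gdStep (h.inner_nonpos n)

theorem Descends.cubic_succ_le (h : Descends A b β ρ X) (hR : Regime A b β ρ) (n : ℕ) :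
    cubic A b ρ (X (n + 1)) ≤
      cubic A b ρ (X n) - 1 / (10 * β) / 2 * ‖cubicGrad A b ρ (X n)‖ ^ 2 := by
  rw [h.step]; exact hR.cubic_gdStep_le (h.inner_nonpos n)

theorem Descends.cubic_le (h : Descends A b β ρ X) (n : ℕ) :
    cubic A b ρ (X n) ≤ -(ρ * ‖X n‖ ^ 3 / 6) :=
  cubic_le_of_inner_nonpos (h.inner_nonpos n) (h.inner_left_nonpos n)

/-- Convergence in value while the model is weakly convex at the iterates. -/
theorem Descends.gap_le (h : Descends A b β ρ X) (hR : Regime A b β ρ) {u : E d} {c D : ℝ}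
    {n : ℕ} (hc : 0 ≤ c)
    (hconv : ∀ t < n, ∀ v, -(c * ‖v‖ ^ 2) ≤ inner ℝ v (A v) + ρ * ‖X t‖ * ‖v‖ ^ 2)
    (hD : ∀ t ≤ n, ‖X t - u‖ ^ 2 ≤ D) :
    2 * (1 / (10 * β)) * n * (cubic A b ρ (X n) - cubic A b ρ u) ≤
      D + n * (1 / (10 * β)) * c * D := by
  have hη0 : 0 < 1 / (10 * β) := by have := hR.β_pos; positivity
  set η := 1 / (10 * β) with hη
  -- This is the usual potential of gradient descent. Each step adds at most `ηcD`; the decrease of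
  -- the model absorbs `η²‖∇f‖²`.
  suffices H : ∀ k ≤ n, ‖X k - u‖ ^ 2 + 2 * η * k * (cubic A b ρ (X k) - cubic A b ρ u) ≤
      D + k * η * c * D by
    have := H n le_rfl
    nlinarith [sq_nonneg ‖X n - u‖]
  intro k
  induction k with
  | zero => intro _; simpa using hD 0 (Nat.zero_le _)
  | succ k ih =>
    intro hk
    have ih := ih (by omega)
    have h1 := h.cubic_succ_le hR k
    have h2 := cubic_sub hR.symm b ρ (X k) u
    have h3 := hconv k (by omega) (u - X k)
    have h4 := hD k (by omega)
    rw [norm_sub_rev] at h4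
    have h5 : 0 ≤ ρ / 6 * (‖u‖ - ‖X k‖) ^ 2 * (2 * ‖u‖ + ‖X k‖) := by
      have := hR.ρ_pos; positivity
    have h6 : ‖X (k + 1) - u‖ ^ 2 = ‖X k - u‖ ^ 2
        + 2 * η * inner ℝ (cubicGrad A b ρ (X k)) (u - X k)
        + η ^ 2 * ‖cubicGrad A b ρ (X k)‖ ^ 2 := by
      rw [h.step, gdStep, sub_right_comm, norm_sub_sq_real, real_inner_smul_right, norm_smul,
        Real.norm_of_nonneg hη0.le, real_inner_comm, ← neg_sub u (X k), inner_neg_right]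
      ring
    rw [← hη] at h1
    set G := ‖cubicGrad A b ρ (X k)‖ ^ 2
    set I := inner ℝ (cubicGrad A b ρ (X k)) (u - X k)
    have hG : 0 ≤ G := sq_nonneg _
    have h7 : I ≤ cubic A b ρ u - cubic A b ρ (X k) + 1 / 2 * (c * D) := by nlinarith
    have h8 : 2 * η * I ≤ 2 * η * (cubic A b ρ u - cubic A b ρ (X k) + 1 / 2 * (c * D)) := by
      gcongr
    have h9 : 2 * η * (η / 2 * G) ≤ 2 * η * (cubic A b ρ (X k) - cubic A b ρ (X (k + 1))) := by
      gcongr; linarith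
    have h10 : 2 * η * k * (cubic A b ρ (X (k + 1))) ≤ 2 * η * k * cubic A b ρ (X k) := by
      gcongr
      nlinarith [mul_nonneg hη0.le hG]
    push_cast
    rw [h6]
    linarith

theorem norm_sub_sq_le {x u : E d} {l : ℝ} (hx : ‖x‖ ≤ l) (hu : ‖u‖ ≤ l) :
    ‖x - u‖ ^ 2 ≤ 4 * l ^ 2 := by
  have := norm_sub_le x u
  nlinarith [norm_nonneg (x - u)]

theorem Descends.norm_lt (h : Descends A b β ρ X) (hρ : 0 < ρ) {l : ℝ} (hl : 0 < l)
    (hu : ∀ u, ‖u‖ ≤ l → -(ρ * l ^ 3 / 6) < cubic A b ρ u) (t : ℕ) : ‖X t‖ < l := by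
  by_contra! hc
  obtain ⟨u, hul, hlow⟩ := exists_le_of_norm_ge hρ hl (h.inner_nonpos t) (h.inner_left_nonpos t) hc
  linarith [hu u hul]

/-- If the model has no low value in the ball of radius `l`, gradient descent reaches a small
gradient quickly. -/
theorem Descends.exists_small_grad (h : Descends A b β ρ X) (hR : Regime A b β ρ) {l : ℝ}
    (hl : 0 < l) (hu : ∀ u, ‖u‖ ≤ l → -(ρ * l ^ 3 / 6) < cubic A b ρ u) {n : ℕ}
    (hn : 10 * β / (ρ * l) ≤ n) :
    ∃ t < 2 * n, ‖cubicGrad A b ρ (X t)‖ ≤ 9 * ρ * l ^ 2 / 2 := by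
  have hβ := hR.β_pos
  have hρ := hR.ρ_pos
  by_contra! hc
  have hnorm := h.norm_lt hρ hl hu
  have hlow := lower_bound_of_forall_cubic hl hu
  -- The first `n` steps bring the model close to its value at `X (2n)`. If the gradients of the
  -- next `n` steps all stayed large, the decrease would be too big: with `y = nηρl ≥ 1` it would
  -- force `(81/4)y² ≤ 4 + 4y`.
  have hgap := h.gap_le hR (u := X (n + n)) (c := ρ * l) (D := 4 * l ^ 2) (n := n) (by positivity)
    (fun t _ v => by
      have := hlow v
      have : 0 ≤ ρ * ‖X t‖ * ‖v‖ ^ 2 := by positivity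
      linarith)
    (fun t _ => norm_sub_sq_le (hnorm t).le (hnorm _).le)
  have hη0 : 0 < 1 / (10 * β) := by positivity
  have hy : 1 ≤ n * (1 / (10 * β)) * (ρ * l) := by
    rw [div_le_iff₀ (by positivity)] at hn
    rw [mul_one_div, div_mul_eq_mul_div, le_div_iff₀ (by positivity)]
    linarith
  have hdesc : ∀ k ≤ n, cubic A b ρ (X (n + k)) ≤
      cubic A b ρ (X n) - k * (1 / (10 * β) / 2 * (9 * ρ * l ^ 2 / 2) ^ 2) := by
    intro k
    induction k with
    | zero => intro _; simp
    | succ k ih =>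
      intro hk
      have h1 := ih (by omega)
      have h2 := h.cubic_succ_le hR (n + k)
      have h3 := hc (n + k) (by omega)
      have h4 : 1 / (10 * β) / 2 * (9 * ρ * l ^ 2 / 2) ^ 2 ≤
          1 / (10 * β) / 2 * ‖cubicGrad A b ρ (X (n + k))‖ ^ 2 := by gcongr
      rw [← add_assoc]
      push_cast
      linarith
  have h1 := hdesc n le_rfl
  set η := 1 / (10 * β)
  have h2 : 2 * η * n * (n * (η / 2 * (9 * ρ * l ^ 2 / 2) ^ 2)) ≤
      4 * l ^ 2 + n * η * (ρ * l) * (4 * l ^ 2) := by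
    refine le_trans ?_ hgap
    gcongr
    linarith
  set y := n * η * (ρ * l) with hyd
  have h3 : 2 * η * n * (n * (η / 2 * (9 * ρ * l ^ 2 / 2) ^ 2)) = 81 / 4 * y ^ 2 * l ^ 2 := by
    rw [hyd]; ring
  rw [h3] at h2
  nlinarith [pow_pos hl 2, mul_pos (pow_pos hl 2) (show 0 < 81 / 4 * y ^ 2 - 4 * y - 4 by nlinarith)]

/-! ### Escape from negative curvature by geometric growth -/

theorem le_mul_of_growth {z : ℕ → ℝ} {κ η : ℝ} {n : ℕ} (hκ : 0 ≤ κ) (h0 : 0 ≤ z 0)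
    (h : ∀ k < n, (1 + κ) * z k + η ≤ z (k + 1)) : η * ((1 + κ) ^ n - 1) ≤ κ * z n := by
  induction n with
  | zero => simpa using mul_nonneg hκ h0
  | succ n ih =>
    have h1 := ih fun k hk => h k (by omega)
    have h2 := mul_le_mul_of_nonneg_left (h n (by omega)) hκ
    have h3 : (1 + κ) * (η * ((1 + κ) ^ n - 1)) ≤ (1 + κ) * (κ * z n) := by gcongr
    rw [pow_succ]
    nlinarith

theorem one_add_le_pow_of_log_le {κ M : ℝ} {n : ℕ} (hκ : 0 < κ) (hκ1 : κ ≤ 1) (hM : 0 ≤ M)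
    (h : 2 / κ * Real.log (1 + M) ≤ n) : 1 + M ≤ (1 + κ) ^ n := by
  rw [← Real.log_le_log_iff (by linarith) (by positivity), Real.log_pow]
  have h1 := Real.le_log_one_add_of_nonneg hκ.le
  have h2 : κ / 2 ≤ 2 * κ / (κ + 2) := by
    rw [div_le_div_iff₀ (by norm_num) (by linarith)]; nlinarith
  rw [div_mul_eq_mul_div, div_le_iff₀ hκ] at h
  nlinarith [Nat.cast_nonneg (α := ℝ) n]

/-- While the norm is too small to compensate the negative curvature, the bottom component of the
iterates grows geometrically. -/
theorem exists_le_eigenvalue_add_norm {l τ σ : ℝ} {n₁ : ℕ} {i₀ : Fin d}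
    (hR : Regime A b β ρ) (hD : Diagonalizes A e lam)
    (hl : 0 < l) (hρl : ρ * l ≤ β / 3) (hσ : σ = ρ ^ 2 * l ^ 3 / (288 * (β + 2 * ρ * l)))
    (hτ : 0 < τ) (hcomp : σ * τ ≤ |inner ℝ (e i₀) b|)
    (hn₁ : 120 * (10 * β / (ρ * l)) * Real.log (1 + 10 * β / (ρ * l) / τ) ≤ n₁)
    (hnorm : ‖gdIter A b β ρ n₁‖ < l) :
    ∃ t ≤ n₁, -(ρ * l / 60) ≤ lam i₀ + ρ * ‖gdIter A b β ρ t‖ := by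
  have hβ := hR.β_pos
  have hρ := hR.ρ_pos
  obtain ⟨z, hz, hzs⟩ := exists_aligned_gdIter hR hD
  set X := gdIter A b β ρ
  have hN : 30 ≤ 10 * β / (ρ * l) := by rw [le_div_iff₀ (by positivity)]; linarith
  have hσ0 : 0 < σ := by rw [hσ]; positivity
  by_contra! hneg
  set η := 1 / (10 * β) with hη
  have hη0 : 0 < η := by positivity
  set N := 10 * β / (ρ * l) with hNd
  have hN0 : 0 < N := by linarith
  have hηN : η * (ρ * l) = 1 / N := by rw [hη, hNd]; field_simp
  -- As `ηρl = 1/N`, the curvature `-ρl/60` assumed in `hneg` gives the growth factor `1 + 1/(60N)`.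
  have hg := le_mul_of_growth (z := fun k => z k i₀) (κ := 1 / (60 * N)) (η := η) (n := n₁)
    (by positivity) ((hz 0).pos i₀).le (fun k hk => by
      rw [hzs]
      have h1 := hneg k hk.le
      have h2 := (hz k).pos i₀
      have h3 : 1 / (60 * N) ≤ -(η * (lam i₀ + ρ * ‖X k‖)) := by
        have : 1 / (60 * N) = η * (ρ * l / 60) := by
          rw [show η * (ρ * l / 60) = η * (ρ * l) / 60 by ring, hηN]; field_simp
        rw [this]
        nlinarith
      nlinarith)
  have hp : 1 + N / τ ≤ (1 + 1 / (60 * N)) ^ n₁ := by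
    refine one_add_le_pow_of_log_le (by positivity) ?_ (by positivity) ?_
    · rw [div_le_one (by positivity)]; linarith
    · rwa [show 2 / (1 / (60 * N)) = 120 * N by field_simp; norm_num]
  have h1 : η * (N / τ) ≤ 1 / (60 * N) * z n₁ i₀ := by
    refine le_trans ?_ hg
    gcongr
    linarith
  have h2 : |inner ℝ (e i₀) b| * z n₁ i₀ ≤ ‖X n₁‖ := by
    have h3 := abs_real_inner_le_norm (e i₀) (X n₁)
    rw [(hz n₁).coord, abs_neg, abs_mul, abs_of_pos ((hz n₁).pos i₀)] at h3
    simpa using h3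
  have h3 := hnorm
  have h4 : σ * τ * z n₁ i₀ < l :=
    lt_of_le_of_lt (mul_le_mul_of_nonneg_right hcomp ((hz n₁).pos i₀).le) (h2.trans_lt h3)
  have h5 : 60 * N * (η * N) / τ ≤ z n₁ i₀ := by
    calc _ = 60 * N * (η * (N / τ)) := by ring
      _ ≤ 60 * N * (1 / (60 * N) * z n₁ i₀) := by gcongr
      _ = _ := by field_simp
  have h6 : σ * (60 * N * (η * N)) < l := by
    calc _ = σ * τ * (60 * N * (η * N) / τ) := by field_simp
      _ ≤ σ * τ * z n₁ i₀ := by gcongr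
      _ < l := h4
  -- By `ρl ≤ β/3` the right side is at least `5l/4`, contradicting `h6`.
  have h7 : σ * (60 * N * (η * N)) = 600 * β * l / (288 * (β + 2 * ρ * l)) := by
    rw [hσ, hη, hNd]; field_simp; norm_num
  rw [h7, div_lt_iff₀ (by positivity)] at h6
  nlinarith [mul_pos hl hβ, mul_le_mul_of_nonneg_left hρl hl.le]

/-- If the perturbed linear term has a component along the bottom eigenvector, gradient descent
on the perturbed model reaches a low value of the unperturbed one. -/
theorem exists_cubic_le {b' : E d} {l τ σ : ℝ} {n₁ n₂ : ℕ} {u : E d} {i₀ : Fin d}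
    (hR : Regime A b' β ρ) (hD : Diagonalizes A e lam) (hmin : ∀ i, lam i₀ ≤ lam i)
    (hl : 0 < l) (hρl : ρ * l ≤ β / 3) (hσ : σ = ρ ^ 2 * l ^ 3 / (288 * (β + 2 * ρ * l)))
    (hb : ‖b' - b‖ ≤ σ) (hu : ‖u‖ ≤ l) (hlow : cubic A b ρ u ≤ -(ρ * l ^ 3 / 6)) (hτ : 0 < τ)
    (hcomp : σ * τ ≤ |inner ℝ (e i₀) b'|)
    (hn₁ : 120 * (10 * β / (ρ * l)) * Real.log (1 + 10 * β / (ρ * l) / τ) ≤ n₁)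
    (hn₂ : 50 * (10 * β / (ρ * l)) ≤ n₂) :
    ∃ t, 1 ≤ t ∧ t ≤ n₁ + n₂ ∧ cubic A b ρ (gdIter A b' β ρ t) ≤ -(ρ * l ^ 3 / 12) := by
  have hβ := hR.β_pos
  have hρ := hR.ρ_pos
  by_contra! hc
  have hX := descends_gdIter hR
  set X := gdIter A b' β ρ
  have hN : 30 ≤ 10 * β / (ρ * l) := by rw [le_div_iff₀ (by positivity)]; linarith
  have hσ0 : 0 < σ := by rw [hσ]; positivity
  have hσ1 : σ ≤ ρ * l ^ 2 / 864 := by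
    rw [hσ, div_le_div_iff₀ (by positivity) (by norm_num)]
    have h1 : 864 * (ρ * l) ≤ 288 * (β + 2 * ρ * l) := by linarith
    have h2 := mul_le_mul_of_nonneg_left h1 (show 0 ≤ ρ * l ^ 2 by positivity)
    linarith
  have hpert : ∀ x, ‖x‖ ≤ l → |cubic A b' ρ x - cubic A b ρ x| ≤ ρ * l ^ 3 / 864 := by
    intro x hx
    rw [← add_sub_cancel b b', cubic_add_left, add_sub_cancel_left]
    calc _ ≤ ‖b' - b‖ * ‖x‖ := abs_real_inner_le_norm _ _
      _ ≤ (ρ * l ^ 2 / 864) * l := by gcongr; linarith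
      _ = _ := by ring
  have hn₂1 : 1 ≤ n₂ := by
    have : (1 : ℝ) ≤ n₂ := by linarith
    exact_mod_cast this
  have hmono := hX.norm_mono hR
  -- A norm `≥ l` would put the perturbed model at or below `-ρ‖x‖³/6`, and a perturbation of size
  -- at most `ρl²/864` cannot lift this above `-ρl³/12`.
  have hnorm : ∀ t ≤ n₁ + n₂, ‖X t‖ < l := by
    intro t ht
    refine lt_of_le_of_lt (hmono ht) ?_
    by_contra! hge
    have h1 := hX.cubic_le (n₁ + n₂)
    have h2 := hc (n₁ + n₂) (by omega) le_rfl
    set x := X (n₁ + n₂)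
    have h3 : cubic A b ρ x ≤ cubic A b' ρ x + σ * ‖x‖ := by
      rw [← add_sub_cancel b b', cubic_add_left]
      have := neg_le_of_abs_le (abs_real_inner_le_norm (b' - b) x)
      have : ‖b' - b‖ * ‖x‖ ≤ σ * ‖x‖ := by gcongr
      linarith
    have h4 : ‖x‖ * (ρ * l ^ 2) ≤ ‖x‖ * (ρ * ‖x‖ ^ 2) := by gcongr
    have h5 : l * (ρ * l ^ 2) ≤ ‖x‖ * (ρ * l ^ 2) := by gcongr
    have h6 : σ * ‖x‖ ≤ ρ * l ^ 2 / 864 * ‖x‖ := by gcongr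
    nlinarith
  obtain ⟨t₀, ht₀, hlam⟩ :=
    exists_le_eigenvalue_add_norm hR hD hl hρl hσ hτ hcomp hn₁ (hnorm n₁ (by omega))
  -- The bound found at time `t₀ ≤ n₁` persists because the norm is nondecreasing and `lam i₀` is
  -- the least eigenvalue.
  have hgap := (hX.shift n₁).gap_le hR (u := u) (c := ρ * l / 60) (D := 4 * l ^ 2) (n := n₂)
    (by positivity)
    (fun t _ v => by
      have h1 := hD.mul_norm_sq_le hmin v
      have h2 : ρ * ‖X t₀‖ ≤ ρ * ‖X (n₁ + t)‖ :=
        mul_le_mul_of_nonneg_left (hmono (by omega)) hρ.le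
      nlinarith [sq_nonneg ‖v‖])
    (fun t ht => norm_sub_sq_le (hnorm _ (by omega)).le hu)
  have hlast := hc (n₁ + n₂) (by omega) le_rfl
  have hp1 := (abs_le.1 (hpert u hu)).2
  have hp2 := (abs_le.1 (hpert _ (hnorm (n₁ + n₂) le_rfl).le)).1
  have hy : 50 ≤ n₂ * (1 / (10 * β)) * (ρ * l) := by
    rw [mul_div_assoc', div_le_iff₀ (by positivity)] at hn₂
    rw [mul_one_div, div_mul_eq_mul_div, le_div_iff₀ (by positivity)]
    linarith
  set η := 1 / (10 * β)
  have hη0 : 0 < η := by positivity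
  -- Here `1/6 - 1/12 - 2/864 > 4/50`. Then `hgap` would require `(8/50)y ≤ 4 + (4/60)y`, false for
  -- `y ≥ 50`.
  have hdiff : ρ * l ^ 3 * (4 / 50) ≤ cubic A b' ρ (X (n₁ + n₂)) - cubic A b' ρ u := by
    have : 0 < ρ * l ^ 3 := by positivity
    linarith
  set F := cubic A b' ρ (X (n₁ + n₂)) - cubic A b' ρ u
  have h1 : 2 * η * n₂ * (ρ * l ^ 3 * (4 / 50)) ≤ 2 * η * n₂ * F := by gcongr
  set y := n₂ * η * (ρ * l) with hyd
  have h2 : 2 * η * n₂ * (ρ * l ^ 3 * (4 / 50)) = 8 / 50 * y * l ^ 2 := by rw [hyd]; ring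
  have h3 : n₂ * η * (ρ * l / 60) * (4 * l ^ 2) = 4 / 60 * y * l ^ 2 := by rw [hyd]; ring
  have h4 : 8 / 50 * y * l ^ 2 ≤ 4 * l ^ 2 + 4 / 60 * y * l ^ 2 := by linarith
  nlinarith [pow_pos hl 2]

end Trajectory

/-! ### Anticoncentration on the sphere -/

/-- A subset of the unit ball that meets every line of a given direction in a set of small diameter
has small volume. -/
theorem volume_le_of_lines (hd : 0 < d) {B : Set (E d)} (hB : MeasurableSet B)
    (hB1 : ∀ x ∈ B, ‖x‖ ≤ 1) {v : E d} (hv : ‖v‖ = 1) {r : ℝ} (hr : 0 < r)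
    (h : ∀ x ∈ B, ∀ s : ℝ, x + s • v ∈ B → |s| < r) :
    volume B ≤ ENNReal.ofReal (3 * d * r) * volume (Metric.ball (0 : E d) 1) := by
  have hd' : (0 : ℝ) < d := by exact_mod_cast hd
  -- More than `1/(dr)` translates of `B`, by multiples of `r` up to `1/d`, are disjoint and fit in
  -- the ball of radius `1 + 1/d`, which has at most `e ≤ 3` times the volume of the unit ball.
  set n := ⌊1 / (d * r)⌋₊ + 1 with hn
  have hn1 : 1 / (d * r) < n := by rw [hn]; push_cast; exact Nat.lt_floor_add_one _
  have hn2 : ∀ i < n, (i : ℝ) * r ≤ 1 / d := by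
    intro i hi
    have h1 : (i : ℝ) ≤ ⌊1 / (d * r)⌋₊ := by exact_mod_cast (show i ≤ ⌊1 / (d * r)⌋₊ by omega)
    have h2 := Nat.floor_le (show 0 ≤ 1 / (d * r) by positivity)
    calc (i : ℝ) * r ≤ 1 / (d * r) * r := by gcongr; linarith
      _ = 1 / d := by field_simp
  let T : ℕ → Set (E d) := fun i => (fun x => x + -(((i : ℝ) * r) • v)) ⁻¹' B
  have hT : ∀ i, MeasurableSet (T i) := fun i => hB.preimage (measurable_add_const _)
  have hvol : ∀ i, volume (T i) = volume B := fun i => measure_preimage_add_right _ _ _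
  have hdisj : (↑(Finset.range n) : Set ℕ).PairwiseDisjoint T := by
    intro i _ j _ hij
    rw [Function.onFun, Set.disjoint_left]
    intro x hxi hxj
    have hs := h _ hxi (((i : ℝ) - j) * r) (by
      have : x + -(((i : ℝ) * r) • v) + (((i : ℝ) - j) * r) • v = x + -(((j : ℝ) * r) • v) := by
        module
      rw [this]; exact hxj)
    rw [abs_mul, abs_of_pos hr] at hs
    have h1 : (1 : ℝ) ≤ |(i : ℝ) - j| := by
      have : (1 : ℤ) ≤ |(i : ℤ) - j| := Int.one_le_abs (by omega)
      exact_mod_cast this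
    nlinarith
  have hsub : (⋃ i ∈ Finset.range n, T i) ⊆ Metric.closedBall (0 : E d) (1 + 1 / d) := by
    simp only [Set.iUnion_subset_iff, Finset.mem_range]
    intro i hi x hx
    rw [mem_closedBall_zero_iff]
    have h1 := hB1 _ hx
    have h2 : ‖((i : ℝ) * r) • v‖ ≤ 1 / d := by
      rw [norm_smul, hv, mul_one, Real.norm_of_nonneg (by positivity)]; exact hn2 i hi
    calc ‖x‖ = ‖x + -(((i : ℝ) * r) • v) + ((i : ℝ) * r) • v‖ := by congr 1; abel
      _ ≤ _ := (norm_add_le _ _).trans (add_le_add h1 h2)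
  have hsum : (n : ENNReal) * volume B ≤ 3 * volume (Metric.ball (0 : E d) 1) := by
    calc (n : ENNReal) * volume B = ∑ i ∈ Finset.range n, volume (T i) := by simp [hvol]
      _ = volume (⋃ i ∈ Finset.range n, T i) :=
        (measure_biUnion_finset hdisj fun i _ => hT i).symm
      _ ≤ volume (Metric.closedBall (0 : E d) (1 + 1 / d)) := measure_mono hsub
      _ = ENNReal.ofReal ((1 + 1 / d) ^ d) * volume (Metric.ball (0 : E d) 1) := by
        rw [Measure.addHaar_closedBall _ _ (by positivity)]; simp
      _ ≤ 3 * volume (Metric.ball (0 : E d) 1) := by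
        gcongr
        rw [show (3 : ENNReal) = ENNReal.ofReal 3 by simp]
        refine ENNReal.ofReal_le_ofReal ?_
        calc (1 + 1 / (d : ℝ)) ^ d ≤ Real.exp (1 / d) ^ d := by
              gcongr; rw [add_comm]; exact Real.add_one_le_exp _
          _ = Real.exp 1 := by rw [← Real.exp_nat_mul]; congr 1; field_simp
          _ ≤ 3 := by have := Real.exp_one_lt_d9; linarith
  calc volume B = ENNReal.ofReal (d * r) * (ENNReal.ofReal (1 / (d * r)) * volume B) := by
        rw [← mul_assoc, ← ENNReal.ofReal_mul (by positivity)]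
        rw [mul_one_div_cancel (by positivity)]; simp
    _ ≤ ENNReal.ofReal (d * r) * ((n : ENNReal) * volume B) := by
        gcongr
        rw [← ENNReal.ofReal_natCast]
        exact ENNReal.ofReal_le_ofReal hn1.le
    _ ≤ ENNReal.ofReal (d * r) * (3 * volume (Metric.ball (0 : E d) 1)) := by gcongr
    _ = _ := by
        rw [← mul_assoc, show (3 : ENNReal) = ENNReal.ofReal 3 by simp,
          ← ENNReal.ofReal_mul (by positivity)]
        congr 2; ring

-- The measure `toSphere` of `s` is `d` times the volume of the cone over `s`, so the normalized
-- measure is the share of the unit ball that the cone occupies.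
open scoped Pointwise in
theorem uniformSphere_le (hd : 0 < d) {s : Set (Metric.sphere (0 : E d) 1)}
    (hs : MeasurableSet s) {K : Set (E d)} {c : ℝ}
    (hK : ∀ r : ℝ, 0 < r → r < 1 → ∀ q ∈ s, r • (q : E d) ∈ K)
    (hvol : volume K ≤ ENNReal.ofReal c * volume (Metric.ball (0 : E d) 1)) :
    uniformSphere d s ≤ ENNReal.ofReal c := by
  have hV : volume (Metric.ball (0 : E d) 1) ≠ 0 := (Metric.measure_ball_pos _ _ one_pos).ne'
  have hV' : volume (Metric.ball (0 : E d) 1) ≠ ⊤ := measure_ball_lt_top.ne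
  have hsub : Set.Ioo (0 : ℝ) 1 • ((↑) '' s : Set (E d)) ⊆ K := by
    rintro _ ⟨r, hr, _, ⟨q, hq, rfl⟩, rfl⟩
    exact hK r hr.1 hr.2 q hq
  have hle := (measure_mono hsub).trans hvol
  rw [uniformSphere, Measure.smul_apply, Measure.toSphere_apply_univ, Measure.toSphere_apply' _ hs,
    smul_eq_mul]
  simp only [finrank_euclideanSpace, Fintype.card_fin]
  have hd0 : (d : ENNReal) ≠ 0 := by exact_mod_cast hd.ne'
  rw [ENNReal.mul_inv (Or.inl hd0) (Or.inr hV)]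
  calc _ ≤ ((d : ENNReal)⁻¹ * (volume (Metric.ball (0 : E d) 1))⁻¹) *
        (d * (ENNReal.ofReal c * volume (Metric.ball (0 : E d) 1))) := by gcongr
    _ = ((d : ENNReal)⁻¹ * d) *
        ((volume (Metric.ball (0 : E d) 1))⁻¹ * volume (Metric.ball (0 : E d) 1)) *
        ENNReal.ofReal c := by ring
    _ = _ := by
      rw [ENNReal.inv_mul_cancel hd0 (by simp), ENNReal.inv_mul_cancel hV hV']; simp

/-- Here `p, q` are the coordinates along `e i` of two points on a line in that direction, and `P,
Q` their norms. Another coordinate of size at least `h` makes the norm vary by a factor `1 - h²/2`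
slower than the coordinate. As `|a| ≤ 1`, this gives `|q - p| ≤ 2τ + (1 - h²/2)|q - p|`, with
strictness from the cone conditions. -/
theorem abs_sub_lt_of_cone {p q P Q h a τ : ℝ} (hh : 0 < h) (hP : p ^ 2 + h ^ 2 ≤ P ^ 2)
    (hQ : q ^ 2 + h ^ 2 ≤ Q ^ 2) (hP0 : 0 ≤ P) (hQ0 : 0 ≤ Q) (hP1 : P ≤ 1) (hQ1 : Q ≤ 1)
    (hPQ : Q ^ 2 - P ^ 2 = q ^ 2 - p ^ 2) (hτ : τ ≤ h ^ 2 / 2) (hp : |p + a * P| < τ * P)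
    (hq : |q + a * Q| < τ * Q) : |q - p| < 4 * τ / h ^ 2 := by
  have hh1 : h ^ 2 ≤ 1 := by nlinarith
  have bound : ∀ p P : ℝ, p ^ 2 + h ^ 2 ≤ P ^ 2 → 0 ≤ P → P ≤ 1 → |p| ≤ (1 - h ^ 2 / 2) * P := by
    intro p P hP hP0 hP1
    refine abs_le_of_sq_le_sq ?_ (mul_nonneg (by linarith) hP0)
    have : P ^ 2 ≤ 1 := by nlinarith
    nlinarith [mul_nonneg (sq_nonneg P) (sq_nonneg (h ^ 2)), mul_nonneg (sq_nonneg h) (sub_nonneg.2 this)]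
  have bp := bound p P hP hP0 hP1
  have bq := bound q Q hQ hQ0 hQ1
  have hPpos : 0 < P := by
    rcases hP0.eq_or_lt with h0 | h0
    · rw [← h0] at hp; simp at hp; linarith [abs_nonneg p]
    · exact h0
  have hQpos : 0 < Q := by
    rcases hQ0.eq_or_lt with h0 | h0
    · rw [← h0] at hq; simp at hq; linarith [abs_nonneg q]
    · exact h0
  have ha : |a| ≤ 1 := by
    have h1 : |a| * P ≤ |p + a * P| + |p| := by
      have : |a * P| ≤ |p + a * P| + |p| := by
        calc |a * P| = |(p + a * P) - p| := by ring_nf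
          _ ≤ _ := abs_sub _ _
      rwa [abs_mul, abs_of_pos hPpos] at this
    have h2 : |a| * P ≤ 1 * P := by nlinarith
    exact le_of_mul_le_mul_right h2 hPpos
  have h1 : |Q - P| ≤ (1 - h ^ 2 / 2) * |q - p| := by
    have h2 : |Q - P| * (Q + P) = |q - p| * |q + p| := by
      calc |Q - P| * (Q + P) = |Q - P| * |Q + P| := by rw [abs_of_pos (add_pos hQpos hPpos)]
        _ = |q - p| * |q + p| := by rw [← abs_mul, ← abs_mul]; congr 1; linarith
    have h3 : |q + p| ≤ (1 - h ^ 2 / 2) * (Q + P) := by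
      have := abs_add_le q p; linarith
    have h4 : |Q - P| * (Q + P) ≤ (1 - h ^ 2 / 2) * |q - p| * (Q + P) := by
      rw [h2]; nlinarith [abs_nonneg (q - p)]
    exact le_of_mul_le_mul_right h4 (by positivity)
  have h5 : |q - p| ≤ |q + a * Q| + |p + a * P| + |a| * |Q - P| := by
    rw [← abs_mul]
    calc |q - p| = |(q + a * Q) - (p + a * P) - a * (Q - P)| := by ring_nf
      _ ≤ |(q + a * Q) - (p + a * P)| + |a * (Q - P)| := abs_sub _ _
      _ ≤ _ := by gcongr; exact abs_sub _ _
  have h6 : |a| * |Q - P| ≤ |Q - P| := by nlinarith [abs_nonneg (Q - P)]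
  have hτ0 : 0 < τ := by
    by_contra! h0
    nlinarith [abs_nonneg (p + a * P)]
  have h7 : τ * P ≤ τ := by nlinarith
  have h8 : τ * Q ≤ τ := by nlinarith
  rw [lt_div_iff₀ (by positivity)]
  nlinarith

/-- The cone over the event is covered by a slab `|x_j| < h` and by the part outside it, where
`abs_sub_lt_of_cone` bounds every chord along `e i`. The choices `h = δ/(12d)` and `4τ/h² = δ/(6d)`
give each piece the share `δ/2`. A second direction `j` is essential: for `d = 1`, `a = 1` the event
has probability `1/2`. -/
theorem uniformSphere_anticoncentration {e : OrthonormalBasis (Fin d) ℝ (E d)} {i j : Fin d}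
    (hij : i ≠ j) (a : ℝ) {δ : ℝ} (hδ : 0 < δ) (hδ1 : δ ≤ 1) :
    uniformSphere d {q | |inner ℝ (e i) (q : E d) + a| < δ ^ 3 / (3456 * d ^ 3)} ≤
      ENNReal.ofReal δ := by
  have hd : 0 < d := i.pos
  have hd1 : (1 : ℝ) ≤ d := by exact_mod_cast hd
  set τ := δ ^ 3 / (3456 * (d : ℝ) ^ 3) with hτd
  set h := δ / (12 * d) with hhd
  have hτ0 : 0 < τ := by positivity
  have hh : 0 < h := by positivity
  have hτ : τ ≤ h ^ 2 / 2 := by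
    have : τ = h ^ 2 * (δ / (24 * d)) := by rw [hτd, hhd]; field_simp; norm_num
    rw [this]
    have : δ / (24 * d) ≤ 1 / 2 := by rw [div_le_div_iff₀ (by positivity) (by norm_num)]; linarith
    nlinarith [sq_nonneg h]
  have hr : 4 * τ / h ^ 2 = δ / (6 * d) := by rw [hτd, hhd]; field_simp; norm_num
  let K₁ : Set (E d) := {x | ‖x‖ ≤ 1 ∧ |inner ℝ (e j) x| < h}
  let K₂ : Set (E d) := {x | ‖x‖ ≤ 1 ∧ h ≤ |inner ℝ (e j) x| ∧
    |inner ℝ (e i) x + a * ‖x‖| < τ * ‖x‖}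
  have hm : ∀ k, Measurable fun x : E d => |inner ℝ (e k) x| := fun k => by fun_prop
  have hK₁ : MeasurableSet K₁ :=
    (measurableSet_le measurable_norm measurable_const).inter (measurableSet_lt (hm j)
      measurable_const)
  have hK₂ : MeasurableSet K₂ :=
    (measurableSet_le measurable_norm measurable_const).inter
      ((measurableSet_le measurable_const (hm j)).inter (measurableSet_lt
        (f := fun x : E d => |inner ℝ (e i) x + a * ‖x‖|) (g := fun x => τ * ‖x‖)
        (by fun_prop) (by fun_prop)))
  have hort : inner ℝ (e j) (e i) = 0 := e.orthonormal.2 hij.symm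
  have v₁ : volume K₁ ≤ ENNReal.ofReal (δ / 2) * volume (Metric.ball (0 : E d) 1) := by
    refine (volume_le_of_lines hd hK₁ (fun x hx => hx.1) (e.norm_eq_one j)
      (r := 2 * h) (by positivity) fun x hx s hy => ?_).trans_eq ?_
    · have h1 := hx.2
      have h2 := hy.2
      rw [inner_add_right, real_inner_smul_right, real_inner_self_eq_norm_sq, e.norm_eq_one] at h2
      rw [abs_lt] at h1 h2 ⊢
      constructor <;> linarith
    · congr 2; rw [hhd]; field_simp; norm_num
  have v₂ : volume K₂ ≤ ENNReal.ofReal (δ / 2) * volume (Metric.ball (0 : E d) 1) := by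
    refine (volume_le_of_lines hd hK₂ (fun x hx => hx.1) (e.norm_eq_one i)
      (r := 4 * τ / h ^ 2) (by positivity) fun x hx s hy => ?_).trans_eq ?_
    · have bessel : ∀ x ∈ K₂, inner ℝ (e i) x ^ 2 + h ^ 2 ≤ ‖x‖ ^ 2 := by
        intro x hx
        have h1 : h ^ 2 ≤ inner ℝ (e j) x ^ 2 := by
          rw [← sq_abs (inner ℝ (e j) x)]; have := hx.2.1; gcongr
        have h2 : ∑ k ∈ {i, j}, inner ℝ (e k) x ^ 2 ≤ ∑ k, inner ℝ (e k) x ^ 2 :=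
          Finset.sum_le_sum_of_subset_of_nonneg (Finset.subset_univ _) fun _ _ _ => sq_nonneg _
        rw [Finset.sum_pair hij] at h2
        have h3 : ‖x‖ ^ 2 = ∑ k, inner ℝ (e k) x ^ 2 := by
          rw [← real_inner_self_eq_norm_sq, inner_eq_sum e x x]
          exact Finset.sum_congr rfl fun _ _ => (sq _).symm
        linarith
      have key := abs_sub_lt_of_cone hh (bessel x hx) (bessel _ hy) (norm_nonneg _) (norm_nonneg _)
        hx.1 hy.1 (by
          rw [norm_add_sq_real, inner_add_right, real_inner_smul_right, real_inner_smul_right,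
            real_inner_self_eq_norm_sq, norm_smul, e.norm_eq_one, real_inner_comm,
            Real.norm_eq_abs, mul_one, sq_abs]
          ring) hτ hx.2.2 hy.2.2
      rwa [inner_add_right, real_inner_smul_right, real_inner_self_eq_norm_sq, e.norm_eq_one,
        add_sub_cancel_left, one_pow, mul_one] at key
    · congr 2; rw [hr]; field_simp; norm_num
  refine uniformSphere_le hd ?_ (K := K₁ ∪ K₂) ?_ ?_
  · refine measurableSet_lt ?_ measurable_const
    fun_prop
  · intro r hr0 hr1 q hq
    have hq1 : ‖(q : E d)‖ = 1 := by simp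
    have hn : ‖r • (q : E d)‖ = r := by rw [norm_smul, hq1, mul_one, Real.norm_of_nonneg hr0.le]
    rcases lt_or_ge |inner ℝ (e j) (r • (q : E d))| h with hlt | hge
    · exact Or.inl ⟨by rw [hn]; exact hr1.le, hlt⟩
    · refine Or.inr ⟨by rw [hn]; exact hr1.le, hge, ?_⟩
      rw [hn, real_inner_smul_right, show r * inner ℝ (e i) (q : E d) + a * r =
        r * (inner ℝ (e i) (q : E d) + a) by ring, abs_mul, abs_of_pos hr0, mul_comm τ]
      exact mul_lt_mul_of_pos_left hq hr0
  · refine (measure_union_le _ _).trans ((add_le_add v₁ v₂).trans_eq ?_)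
    rw [← add_mul, ← ENNReal.ofReal_add (by positivity) (by positivity)]
    congr 2; ring

/-! ### The cubic upper bound -/

theorem gradient_eq_toDual_symm (g : E d → ℝ) :
    gradient g = fun y => (InnerProductSpace.toDual ℝ (E d)).symm (fderiv ℝ g y) := rfl

theorem contDiff_gradient {g : E d → ℝ} (hg : ContDiff ℝ 2 g) : ContDiff ℝ 1 (gradient g) := by
  rw [gradient_eq_toDual_symm]
  exact (InnerProductSpace.toDual ℝ (E d)).symm.toContinuousLinearEquiv.contDiff.comp
    (hg.fderiv_right (by norm_num))

theorem hasFDerivAt_gradient {g : E d → ℝ} (hg : ContDiff ℝ 2 g) (y : E d) :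
    HasFDerivAt (gradient g) (hessian g y) y :=
  ((contDiff_gradient hg).differentiable one_ne_zero y).hasFDerivAt

theorem continuous_hessian {g : E d → ℝ} (hg : ContDiff ℝ 2 g) : Continuous (hessian g) :=
  (contDiff_gradient hg).continuous_fderiv one_ne_zero

theorem hessian_symm {g : E d → ℝ} (hg : ContDiff ℝ 2 g) (y v w : E d) :
    inner ℝ (hessian g y v) w = inner ℝ v (hessian g y w) := by
  have hd : DifferentiableAt ℝ (fderiv ℝ g) y :=
    (hg.fderiv_right (m := 1) (by norm_num)).differentiable one_ne_zero y
  have key : ∀ v w, inner ℝ (hessian g y v) w = fderiv ℝ (fderiv ℝ g) y v w := by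
    intro v w
    have h1 : HasFDerivAt (fun y => fderiv ℝ g y w) ((innerSL ℝ w).comp (hessian g y)) y := by
      refine ((innerSL ℝ w).hasFDerivAt.comp y (hasFDerivAt_gradient hg y)).congr_of_eventuallyEq
        (Filter.Eventually.of_forall fun y => ?_)
      change fderiv ℝ g y w = inner ℝ w (gradient g y)
      rw [real_inner_comm, inner_gradient_left]
    have h2 := (ContinuousLinearMap.apply ℝ ℝ w).hasFDerivAt.comp y hd.hasFDerivAt
    have h3 := congrArg (fun L : E d →L[ℝ] ℝ => L v) (h1.unique h2)
    simpa [real_inner_comm w] using h3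
  have hsymm : IsSymmSndFDerivAt ℝ g y :=
    hg.contDiffAt.isSymmSndFDerivAt (by simp)
  rw [key, hsymm v w, ← key, real_inner_comm]

theorem norm_hessian_le {g : E d → ℝ} {glb β ρ : ℝ} (hβ : 0 ≤ β) (h : IsAdmissible g glb β ρ)
    (y : E d) : ‖hessian g y‖ ≤ β := by
  lift β to NNReal using hβ
  refine norm_fderiv_le_of_lipschitz ℝ (LipschitzWith.of_dist_le_mul fun a b => ?_)
  rw [dist_eq_norm, dist_eq_norm]
  exact h.smooth a b

/-- The mean value inequality loses a factor 2 against integration. This is affordable, because `2 +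
9/2 + 1 ≤ 9` in `isSecondOrderStationary_of_small`. -/
theorem norm_gradient_sub_le {g : E d → ℝ} {glb β ρ : ℝ} (hρ : 0 ≤ ρ)
    (h : IsAdmissible g glb β ρ) (y u : E d) :
    ‖gradient g (y + u) - gradient g y - hessian g y u‖ ≤ 2 * ρ * ‖u‖ ^ 2 := by
  have := (convex_closedBall y ‖u‖).norm_image_sub_le_of_norm_hasFDerivWithin_le'
    (f := gradient g) (f' := hessian g) (φ := hessian g y) (C := 2 * ρ * ‖u‖) (x := y) (y := y + u)
    (fun x _ => (hasFDerivAt_gradient h.contDiff x).hasFDerivWithinAt)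
    (fun x hx => by
      refine (h.hessian_lipschitz x y).trans ?_
      rw [mem_closedBall_iff_norm] at hx
      gcongr)
    (by simp) (by simp)
  rw [add_sub_cancel_left] at this
  linarith

theorem antitoneOn_Ici_of_hasDerivAt {f f' : ℝ → ℝ} (hf : ∀ t, HasDerivAt f (f' t) t)
    (h : ∀ t, 0 ≤ t → f' t ≤ 0) : AntitoneOn f (Set.Ici 0) := by
  refine antitoneOn_of_deriv_nonpos (convex_Ici 0)
    (fun t _ => (hf t).continuousAt.continuousWithinAt)
    (fun t _ => (hf t).differentiableAt.differentiableWithinAt) fun t ht => ?_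
  rw [(hf t).deriv]
  rw [interior_Ici] at ht
  exact h t (le_of_lt ht)

/-- The cubic model majorizes the function. -/
theorem le_add_cubic {g : E d → ℝ} {glb β ρ : ℝ} (h : IsAdmissible g glb β ρ) (y u : E d) :
    g (y + u) ≤ g y + cubic (hessian g y) (gradient g y) ρ u := by
  set H := hessian g y
  set b := gradient g y
  have hline : ∀ t : ℝ, HasDerivAt (fun t : ℝ => y + t • u) u t := fun t => by
    simpa using ((hasDerivAt_id t).smul_const u).const_add y
  -- Taylor's bound along the segment, by monotonicity in place of integrals: the Hessian bound
  -- makes this function, which vanishes at `0`, antitone on `t ≥ 0`. It is the derivative of the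
  -- one in `hψ`.
  have hχ : ∀ t : ℝ, HasDerivAt (fun t : ℝ => inner ℝ (gradient g (y + t • u)) u - inner ℝ b u
      - t * inner ℝ u (H u) - ρ * t ^ 2 * ‖u‖ ^ 3)
      (inner ℝ (hessian g (y + t • u) u) u - inner ℝ u (H u) - 2 * ρ * t * ‖u‖ ^ 3) t := by
    intro t
    have h1 := (hasFDerivAt_gradient h.contDiff (y + t • u)).comp_hasDerivAt t (hline t)
    have h2 := h1.inner ℝ (hasDerivAt_const t u)
    have h3 := ((h2.sub_const (inner ℝ b u)).sub ((hasDerivAt_id t).mul_const (inner ℝ u (H u)))).sub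
      (((hasDerivAt_pow 2 t).const_mul ρ).mul_const (‖u‖ ^ 3))
    refine h3.congr_deriv ?_
    simp only [inner_zero_right, zero_add, one_mul, Nat.cast_ofNat, Nat.add_one_sub_one, pow_one]
    ring
  have hψ : ∀ t : ℝ, HasDerivAt (fun t : ℝ => g (y + t • u) - t * inner ℝ b u
      - t ^ 2 * (1 / 2 * inner ℝ u (H u)) - t ^ 3 * (ρ / 3 * ‖u‖ ^ 3))
      (inner ℝ (gradient g (y + t • u)) u - inner ℝ b u
      - t * inner ℝ u (H u) - ρ * t ^ 2 * ‖u‖ ^ 3) t := by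
    intro t
    have h1 := ((h.contDiff.differentiable two_ne_zero (y + t • u)).hasFDerivAt).comp_hasDerivAt t
      (hline t)
    rw [← inner_gradient_left] at h1
    have h3 := ((h1.sub ((hasDerivAt_id t).mul_const (inner ℝ b u))).sub
      ((hasDerivAt_pow 2 t).mul_const (1 / 2 * inner ℝ u (H u)))).sub
      ((hasDerivAt_pow 3 t).mul_const (ρ / 3 * ‖u‖ ^ 3))
    refine h3.congr_deriv ?_
    simp
    ring
  have hχ0 := antitoneOn_Ici_of_hasDerivAt hχ fun t ht => by
    have h1 := h.hessian_lipschitz (y + t • u) y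
    rw [add_sub_cancel_left, norm_smul, Real.norm_of_nonneg ht] at h1
    have h2 := (hessian g (y + t • u) - H).le_of_opNorm_le h1 u
    have h3 := (le_abs_self _).trans (abs_real_inner_le_norm ((hessian g (y + t • u) - H) u) u)
    rw [sub_apply, inner_sub_left, real_inner_comm u (H u)] at h3
    have h4 : ‖hessian g (y + t • u) u - H u‖ * ‖u‖ ≤ 2 * ρ * (t * ‖u‖) * ‖u‖ * ‖u‖ := by
      gcongr
      exact h2
    linarith
  have hψ0 := antitoneOn_Ici_of_hasDerivAt hψ fun t ht => by
    have := hχ0 Set.self_mem_Ici ht ht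
    simpa [b] using this
  have := hψ0 Set.self_mem_Ici (Set.mem_Ici.2 zero_le_one) zero_le_one
  simp only [one_smul, zero_smul, add_zero, one_pow, one_mul, zero_mul, sub_zero, ne_eq,
    OfNat.ofNat_ne_zero, not_false_eq_true, zero_pow] at this
  simp only [cubic]
  linarith

/-- The output of the final stage is second-order stationary. -/
theorem isSecondOrderStationary_of_small {g : E d → ℝ} {glb β ρ l : ℝ} (hρ : 0 < ρ) (hl : 0 < l)
    (h : IsAdmissible g glb β ρ) {y u : E d} (hu : ‖u‖ ≤ l)
    (hlow : ∀ v, -(ρ * l) * ‖v‖ ^ 2 ≤ inner ℝ v (hessian g y v))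
    (hgrad : ‖cubicGrad (hessian g y) (gradient g y) ρ u‖ ≤ 9 * ρ * l ^ 2 / 2) :
    IsSecondOrderStationary g ρ (9 * ρ * l ^ 2) (y + u) := by
  constructor
  · have h1 := norm_gradient_sub_le hρ.le h y u
    have e : gradient g (y + u) = (gradient g (y + u) - gradient g y - hessian g y u)
        + cubicGrad (hessian g y) (gradient g y) ρ u - (ρ * ‖u‖) • u := by
      simp only [cubicGrad]; abel
    have h2 : ‖(ρ * ‖u‖) • u‖ = ρ * ‖u‖ ^ 2 := by
      rw [norm_smul, Real.norm_of_nonneg (by positivity)]; ring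
    have h3 : ρ * ‖u‖ ^ 2 ≤ ρ * l ^ 2 := by gcongr
    rw [e]
    refine (norm_sub_le _ _).trans ((add_le_add_left (norm_add_le _ _) _).trans ?_)
    have : 0 < ρ * l ^ 2 := by positivity
    linarith
  -- The bound `-ρl` on the Hessian at `y` and its change of at most `2ρl` over a distance `l` add
  -- up to `-3ρl`.
  · have hs : √(ρ * (9 * ρ * l ^ 2)) = 3 * ρ * l := by
      rw [show ρ * (9 * ρ * l ^ 2) = (3 * ρ * l) ^ 2 by ring, Real.sqrt_sq (by positivity)]
    rw [hs, ContinuousLinearMap.le_def]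
    refine ⟨fun v w => ?_, fun v => ?_⟩
    · simp [inner_add_left, inner_add_right, real_inner_smul_left, real_inner_smul_right,
        hessian_symm h.contDiff]
    · have h1 := h.hessian_lipschitz (y + u) y
      rw [add_sub_cancel_left] at h1
      have h2 := (hessian g (y + u) - hessian g y).le_of_opNorm_le h1 v
      have h3 := neg_le_of_abs_le
        (abs_real_inner_le_norm v ((hessian g (y + u) - hessian g y) v))
      rw [sub_apply, inner_sub_right] at h3
      have h4 : ‖v‖ * ‖hessian g (y + u) v - hessian g y v‖ ≤ 2 * (ρ * l) * ‖v‖ ^ 2 := by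
        calc _ ≤ ‖v‖ * (2 * ρ * ‖u‖ * ‖v‖) := by gcongr; exact h2
          _ ≤ ‖v‖ * (2 * ρ * l * ‖v‖) := by gcongr
          _ = _ := by ring
      have h5 := hlow v
      have e : (hessian g (y + u) - -((3 * ρ * l) • ContinuousLinearMap.id ℝ (E d))).reApplyInnerSelf v
          = inner ℝ v (hessian g (y + u) v) + 3 * ρ * l * ‖v‖ ^ 2 := by
        rw [ContinuousLinearMap.reApplyInnerSelf_apply]
        simp [inner_add_left, real_inner_smul_left, hessian_symm h.contDiff]
      rw [e]
      linarith

/-! ### The subproblem solver -/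

/-- The oracle that answers products with `A`. -/
def matOracle (A : E d →L[ℝ] E d) (v : E d) : Counted (E d) := query (A v)

theorem solveLoop_succ (A : E d →L[ℝ] E d) (b b' : E d) (ρ η thr : ℝ) (n : ℕ) (x : E d) :
    solveLoop (matOracle A) b b' ρ η thr (n + 1) x =
      let r : Counted (E d) := if cubic A b ρ (gdStep A b' ρ η x) ≤ thr
        then ⟨gdStep A b' ρ η x, 0⟩
        else solveLoop (matOracle A) b b' ρ η thr n (gdStep A b' ρ η x)
      ⟨r.val, 1 + (1 + r.cost)⟩ := rfl

theorem solveLoop_succ_val (A : E d →L[ℝ] E d) (b b' : E d) (ρ η thr : ℝ) (n : ℕ) (x : E d) :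
    (solveLoop (matOracle A) b b' ρ η thr (n + 1) x).val =
      if cubic A b ρ (gdStep A b' ρ η x) ≤ thr then gdStep A b' ρ η x
      else (solveLoop (matOracle A) b b' ρ η thr n (gdStep A b' ρ η x)).val := by
  simp only [solveLoop_succ]
  split_ifs <;> rfl

theorem solveLoop_cost_le (A : E d →L[ℝ] E d) (b b' : E d) (ρ η thr : ℝ) (n : ℕ) :
    ∀ x, (solveLoop (matOracle A) b b' ρ η thr n x).cost ≤ 2 * n := by
  induction n with
  | zero => intro x; exact le_rfl
  | succ n ih =>
    intro x
    simp only [solveLoop_succ]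
    split_ifs
    · simp only; omega
    · have := ih (gdStep A b' ρ η x); omega

/-- The loop stops at its first good iterate. The value is tested only after a step, hence `1 ≤ t`.
-/
theorem solveLoop_cubic_le (A : E d →L[ℝ] E d) (b b' : E d) (ρ η thr : ℝ) (n : ℕ) :
    ∀ x t, 1 ≤ t → t ≤ n → cubic A b ρ ((gdStep A b' ρ η)^[t] x) ≤ thr →
      cubic A b ρ (solveLoop (matOracle A) b b' ρ η thr n x).val ≤ thr := by
  induction n with
  | zero => intro x t h1 h2; omega
  | succ n ih =>
    intro x t h1 h2 h3
    rw [solveLoop_succ_val]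
    split_ifs with hc
    · exact hc
    · obtain ⟨t, rfl⟩ : ∃ k, t = k + 1 := ⟨t - 1, by omega⟩
      rw [Function.iterate_succ_apply] at h3
      rcases Nat.eq_zero_or_pos t with rfl | ht
      · exact absurd h3 hc
      · exact ih _ t ht (by omega) h3

/-- The size of the perturbation. -/
def pertSize (β ρ slb ε' : ℝ) : ℝ := ρ ^ 2 * slb ^ 3 * ε' / (144 * (β + 2 * ρ * slb))

theorem solveSubproblem_eq (A : E d →L[ℝ] E d) (b : E d) (β ρ η slb ε' δ : ℝ) (q : E d) :
    solveSubproblem (matOracle A) b β ρ η slb ε' δ q =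
      let L := solveLoop (matOracle A) b (b + pertSize β ρ slb ε' • q) ρ η
        (-((1 - ε') * ρ * slb ^ 3 / 6)) (maxSteps d ρ η slb ε' δ)
        (cauchyPt A (b + pertSize β ρ slb ε' • q) ρ)
      let r : Counted (E d) :=
        if cubic A b ρ (cauchyPt A b ρ) ≤ -((1 - ε') * ρ * slb ^ 3 / 6) then ⟨cauchyPt A b ρ, 0⟩
        else ⟨L.val, 1 + L.cost⟩
      ⟨r.val, 1 + (1 + r.cost)⟩ := rfl

theorem solveSubproblem_val (A : E d →L[ℝ] E d) (b : E d) (β ρ η slb ε' δ : ℝ) (q : E d) :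
    (solveSubproblem (matOracle A) b β ρ η slb ε' δ q).val =
      if cubic A b ρ (cauchyPt A b ρ) ≤ -((1 - ε') * ρ * slb ^ 3 / 6) then cauchyPt A b ρ
      else (solveLoop (matOracle A) b (b + pertSize β ρ slb ε' • q) ρ η
        (-((1 - ε') * ρ * slb ^ 3 / 6)) (maxSteps d ρ η slb ε' δ)
        (cauchyPt A (b + pertSize β ρ slb ε' • q) ρ)).val := by
  simp only [solveSubproblem_eq]
  split_ifs <;> rfl

theorem solveSubproblem_cost_le (A : E d →L[ℝ] E d) (b : E d) (β ρ η slb ε' δ : ℝ) (q : E d) :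
    (solveSubproblem (matOracle A) b β ρ η slb ε' δ q).cost ≤
      3 + 2 * maxSteps d ρ η slb ε' δ := by
  simp only [solveSubproblem_eq]
  have := solveLoop_cost_le A b (b + pertSize β ρ slb ε' • q) ρ η
    (-((1 - ε') * ρ * slb ^ 3 / 6)) (maxSteps d ρ η slb ε' δ)
    (cauchyPt A (b + pertSize β ρ slb ε' • q) ρ)
  split_ifs <;> simp only <;> omega

/-- The budget covers a growth phase `n₁`, with `τ` from the anticoncentration bound, and a nearly
convex phase `n₂`. The logarithm is absorbed through `d³/δ³ ≤ (√d/δ)⁶` and `(12N)⁴`. -/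
theorem le_maxSteps (hd : 0 < d) {β ρ l δ : ℝ} (hβ : 0 < β) (hρ : 0 < ρ) (hl : 0 < l)
    (hρl : ρ * l ≤ β / 3) (hδ : 0 < δ) (hδ1 : δ ≤ 1) :
    ∃ n₁ n₂ : ℕ, n₁ + n₂ ≤ maxSteps d ρ (1 / (10 * β)) l (1 / 2) δ ∧
      120 * (10 * β / (ρ * l)) *
        Real.log (1 + 10 * β / (ρ * l) / (δ ^ 3 / (3456 * d ^ 3))) ≤ n₁ ∧
      50 * (10 * β / (ρ * l)) ≤ n₂ := by
  have hN : 30 ≤ 10 * β / (ρ * l) := by rw [le_div_iff₀ (by positivity)]; linarith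
  have e1 : 240 / (1 / (10 * β) * ρ * l * (1 / 2)) = 480 * (10 * β / (ρ * l)) := by
    field_simp; norm_num
  have e2 : 6 / (1 / (10 * β) * ρ * l * (1 / 2)) = 12 * (10 * β / (ρ * l)) := by
    field_simp; norm_num
  rw [maxSteps, e1, e2]
  set N := 10 * β / (ρ * l)
  have hd1 : (1 : ℝ) ≤ d := by exact_mod_cast hd
  have hs : 1 ≤ √(d : ℝ) := by rw [Real.one_le_sqrt]; exact hd1
  have hs2 : √(d : ℝ) ^ 2 = d := Real.sq_sqrt (by positivity)
  set s := √(d : ℝ)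
  have hL2 : 1 ≤ Real.log (12 * N) := by
    rw [Real.le_log_iff_exp_le (by positivity)]
    have := Real.exp_one_lt_d9
    linarith
  have hL1 : 0 ≤ Real.log (1 + s / δ) := Real.log_nonneg (by
    have : 0 ≤ s / δ := by positivity
    linarith)
  have hlog : Real.log (1 + N / (δ ^ 3 / (3456 * (d : ℝ) ^ 3))) ≤
      6 * Real.log (1 + s / δ) + 4 * Real.log (12 * N) := by
    have hx : 0 ≤ s / δ := by positivity
    rw [show 6 * Real.log (1 + s / δ) + 4 * Real.log (12 * N) =
      Real.log ((1 + s / δ) ^ 6 * (12 * N) ^ 4) by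
        rw [Real.log_mul (x := (1 + s / δ) ^ 6) (by positivity) (by positivity), Real.log_pow,
          Real.log_pow]; simp only [Nat.cast_ofNat]]
    refine Real.log_le_log (by positivity) ?_
    have h1 : N / (δ ^ 3 / (3456 * (d : ℝ) ^ 3)) ≤ 3456 * N * (s / δ) ^ 6 := by
      rw [← hs2]
      calc N / (δ ^ 3 / (3456 * (s ^ 2) ^ 3)) = 3456 * N * s ^ 6 * (1 / δ ^ 3) := by
            field_simp
        _ ≤ 3456 * N * s ^ 6 * (1 / δ ^ 6) := by
            gcongr 3456 * N * s ^ 6 * (1 / ?_)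
            exact pow_le_pow_of_le_one hδ.le hδ1 (by norm_num)
        _ = _ := by field_simp
    have h2 : 3456 * N ≤ (12 * N) ^ 4 - 1 := by
      have : (30 : ℝ) ^ 3 ≤ N ^ 3 := by gcongr
      nlinarith
    have h3 : (s / δ) ^ 6 ≤ (1 + s / δ) ^ 6 := by gcongr; linarith
    have h4 : 1 ≤ (1 + s / δ) ^ 6 := one_le_pow₀ (by linarith)
    calc 1 + N / (δ ^ 3 / (3456 * (d : ℝ) ^ 3)) ≤ 1 + 3456 * N * (s / δ) ^ 6 := by linarith
      _ ≤ (1 + s / δ) ^ 6 + ((12 * N) ^ 4 - 1) * (1 + s / δ) ^ 6 := by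
        gcongr
        linarith
      _ = _ := by ring
  refine ⟨_, _, ?_, Nat.le_ceil _, Nat.le_ceil _⟩
  set L1 := Real.log (1 + s / δ)
  set L2 := Real.log (12 * N)
  set L3 := Real.log (1 + N / (δ ^ 3 / (3456 * (d : ℝ) ^ 3)))
  have hL3 : 0 ≤ L3 := Real.log_nonneg (by
    have : 0 ≤ N / (δ ^ 3 / (3456 * (d : ℝ) ^ 3)) := by positivity
    linarith)
  have c1 := (Nat.ceil_lt_add_one (show 0 ≤ 120 * N * L3 by positivity)).le
  have c2 := (Nat.ceil_lt_add_one (show 0 ≤ 50 * N by positivity)).le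
  have c3 := Nat.le_ceil (480 * N * (6 * L1 + 32 * L2))
  have c4 : 120 * N * L3 ≤ 120 * N * (6 * L1 + 4 * L2) := by gcongr
  have c5 : 0 ≤ N * L1 := by positivity
  have c6 : N * 1 ≤ N * L2 := by gcongr
  have : (⌈120 * N * L3⌉₊ + ⌈50 * N⌉₊ : ℝ) ≤ ⌈480 * N * (6 * L1 + 32 * L2)⌉₊ := by nlinarith
  exact_mod_cast this

theorem pertSize_half (β ρ l : ℝ) :
    pertSize β ρ l (1 / 2) = ρ ^ 2 * l ^ 3 / (288 * (β + 2 * ρ * l)) := by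
  rw [pertSize, ← mul_div_assoc, mul_one, div_div]
  congr 1; ring

/-- In dimension one, the Cauchy point minimizes the model. -/
theorem cubic_cauchyPt_le_of_subsingleton [Subsingleton (Fin d)] {A : E d →L[ℝ] E d} {b : E d}
    {ρ : ℝ} (hρ : 0 < ρ) (hA : ∀ x y, inner ℝ (A x) y = inner ℝ x (A y)) (hb : b ≠ 0) (u : E d) :
    cubic A b ρ (cauchyPt A b ρ) ≤ cubic A b ρ u := by
  obtain ⟨e, lam, hD⟩ := exists_diagonalizes hA
  have hi : Nonempty (Fin d) := by
    by_contra hne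
    rw [not_nonempty_iff] at hne
    exact hb (Subsingleton.elim _ _)
  obtain ⟨i⟩ := hi
  have hin : ∀ x y : E d, inner ℝ x y = inner ℝ (e i) x * inner ℝ (e i) y := fun x y => by
    rw [inner_eq_sum e x y, Fintype.sum_subsingleton _ i]
  set x := cauchyPt A b ρ with hx
  have hx0 : 0 < ‖x‖ := by rw [norm_cauchyPt hρ hb]; exact cauchyRadius_pos hρ hb
  have hxi : inner ℝ (e i) x ≠ 0 := by
    intro h0
    have := hin x x
    rw [real_inner_self_eq_norm_sq, h0] at this
    simp at this
    simp [this] at hx0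
  -- On a line, stationarity along the ray is full stationarity.
  have hG : inner ℝ (e i) (cubicGrad A b ρ x) = 0 := by
    have := inner_cauchyPt_cubicGrad (A := A) (b := b) hρ
    rw [← hx, hin] at this
    exact (mul_eq_zero.1 this).resolve_left hxi
  -- Stationarity reads `b = -(λ + ρ‖x‖)x`, and `⟨b, x⟩ ≤ 0`.
  have hμ : 0 ≤ lam i + ρ * ‖x‖ := by
    have h1 : inner ℝ (e i) b = -((lam i + ρ * ‖x‖) * inner ℝ (e i) x) := by
      simp only [cubicGrad, inner_add_right, real_inner_smul_right, hD.apply_eq] at hG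
      linarith
    have h2 := inner_cauchyPt_le (A := A) (b := b) hρ
    rw [← hx, hin, h1] at h2
    have h3 : 0 < inner ℝ (e i) x ^ 2 := by positivity
    by_contra! hneg
    nlinarith
  have key := cubic_sub hA b ρ x u
  have h1 : inner ℝ (cubicGrad A b ρ x) (u - x) = 0 := by rw [hin, hG, zero_mul]
  have h2 : inner ℝ (u - x) (A (u - x)) + ρ * ‖x‖ * ‖u - x‖ ^ 2 =
      (lam i + ρ * ‖x‖) * ‖u - x‖ ^ 2 := by
    rw [hin (u - x) (A (u - x)), hD.apply_eq, ← real_inner_self_eq_norm_sq, hin (u - x) (u - x)]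
    ring
  rw [h1, h2] at key
  have h3 : 0 ≤ ρ / 6 * (‖u‖ - ‖x‖) ^ 2 * (2 * ‖u‖ + ‖x‖) := by positivity
  have h4 : 0 ≤ (lam i + ρ * ‖x‖) * ‖u - x‖ ^ 2 := by positivity
  linarith

/-- The result of the subproblem solver with the parameters of the majorization method. -/
def solverOut (A : E d →L[ℝ] E d) (b : E d) (β ρ l δ : ℝ) (q : E d) : E d :=
  (solveSubproblem (matOracle A) b β ρ (1 / (10 * β)) l (1 / 2) δ q).val

/-- The deterministic half of the solver's guarantee. If the Cauchy point is rejected it lies in the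
ball, so `b` is small and the perturbed model is in the `Regime`. The component bound is asked for
only in that case, which in dimension one forces `b = 0`. -/
theorem solverOut_cubic_le (hd : 0 < d) {A : E d →L[ℝ] E d} {b u q : E d} {β ρ l δ : ℝ}
    {e : OrthonormalBasis (Fin d) ℝ (E d)} {lam : Fin d → ℝ} {i₀ : Fin d}
    (hβ : 0 < β) (hρ : 0 < ρ) (hl : 0 < l) (hρl : ρ * l ≤ β / 3) (hδ : 0 < δ) (hδ1 : δ ≤ 1)
    (hA : ∀ x y, inner ℝ (A x) y = inner ℝ x (A y)) (hAβ : ‖A‖ ≤ β)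
    (hD : Diagonalizes A e lam) (hmin : ∀ i, lam i₀ ≤ lam i)
    (hu : ‖u‖ ≤ l) (hlow : cubic A b ρ u ≤ -(ρ * l ^ 3 / 6)) (hq : ‖q‖ = 1)
    (hcomp : -(ρ * l ^ 3 / 12) < cubic A b ρ (cauchyPt A b ρ) →
      pertSize β ρ l (1 / 2) * (δ ^ 3 / (3456 * d ^ 3)) ≤
        |inner ℝ (e i₀) (b + pertSize β ρ l (1 / 2) • q)|) :
    cubic A b ρ (solverOut A b β ρ l δ q) ≤ -(ρ * l ^ 3 / 12) := by
  have hthr : -((1 - 1 / 2) * ρ * l ^ 3 / 6) = -(ρ * l ^ 3 / 12) := by ring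
  rw [solverOut, solveSubproblem_val, hthr]
  split_ifs with hc
  · exact hc
  · push Not at hc
    have hcomp := hcomp hc
    have hσ := pertSize_half β ρ l
    set σ := pertSize β ρ l (1 / 2)
    have hσ0 : 0 < σ := by rw [hσ]; positivity
    have hn : ‖cauchyPt A b ρ‖ ≤ l := by
      by_contra! hlt
      have h1 := cubic_le_of_inner_nonpos (inner_cauchyPt_cubicGrad (A := A) (b := b) hρ).le
        (inner_cauchyPt_le hρ)
      have h2 : ρ * l ^ 3 ≤ ρ * ‖cauchyPt A b ρ‖ ^ 3 := by gcongr
      have : 0 < ρ * l ^ 3 := by positivity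
      linarith
    have hb := norm_le_of_norm_cauchyPt_le hρ hβ hAβ hl hn
    have hpert : ‖b + σ • q - b‖ ≤ σ := by
      rw [add_sub_cancel_left, norm_smul, hq, mul_one, Real.norm_of_nonneg hσ0.le]
    have hR : Regime A (b + σ • q) β ρ := by
      refine ⟨hβ, hρ, hA, hAβ, ?_⟩
      have h1 : ‖b + σ • q‖ ≤ (β + ρ * l) * l + σ := by
        refine (norm_add_le _ _).trans (add_le_add hb ?_)
        rwa [add_sub_cancel_left] at hpert
      have h2 : ρ * ‖b + σ • q‖ ≤ (β + ρ * l) * (ρ * l) + ρ * σ := by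
        calc _ ≤ ρ * ((β + ρ * l) * l + σ) := by gcongr
          _ = _ := by ring
      have h3 : ρ * σ ≤ (ρ * l) ^ 2 / 288 := by
        rw [hσ, ← mul_div_assoc, div_le_div_iff₀ (by positivity) (by norm_num)]
        have h4 : ρ * l ≤ β + 2 * ρ * l := by nlinarith [mul_pos hρ hl]
        nlinarith [mul_le_mul_of_nonneg_left h4 (show 0 ≤ (ρ * l) ^ 2 by positivity)]
      have h4 : 0 < ρ * l := by positivity
      nlinarith
    obtain ⟨n₁, n₂, hle, h1, h2⟩ := le_maxSteps hd hβ hρ hl hρl hδ hδ1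
    obtain ⟨t, ht1, ht2, ht3⟩ := exists_cubic_le hR hD hmin hl hρl hσ hpert hu hlow
      (show 0 < δ ^ 3 / (3456 * (d : ℝ) ^ 3) by positivity) hcomp h1 h2
    exact solveLoop_cubic_le _ _ _ _ _ _ _ _ t ht1 (ht2.trans hle) ht3

/-- If the model has a low value in the ball of radius `l`, the subproblem solver fails with
probability at most `δ`. -/
theorem uniformSphere_solver_fails_le (hd : 0 < d) {A : E d →L[ℝ] E d} {b u : E d} {β ρ l δ : ℝ}
    (hβ : 0 < β) (hρ : 0 < ρ) (hl : 0 < l) (hρl : ρ * l ≤ β / 3) (hδ : 0 < δ) (hδ1 : δ ≤ 1)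
    (hA : ∀ x y, inner ℝ (A x) y = inner ℝ x (A y)) (hAβ : ‖A‖ ≤ β)
    (hu : ‖u‖ ≤ l) (hlow : cubic A b ρ u ≤ -(ρ * l ^ 3 / 6)) :
    uniformSphere d {q | -(ρ * l ^ 3 / 12) < cubic A b ρ (solverOut A b β ρ l δ q)} ≤
      ENNReal.ofReal δ := by
  obtain ⟨e, lam, hD⟩ := exists_diagonalizes hA
  have : Nonempty (Fin d) := ⟨⟨0, hd⟩⟩
  obtain ⟨i₀, -, hmin⟩ := Finset.exists_min_image Finset.univ lam Finset.univ_nonempty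
  replace hmin : ∀ i, lam i₀ ≤ lam i := fun i => hmin i (Finset.mem_univ i)
  have hσ0 : 0 < pertSize β ρ l (1 / 2) := by rw [pertSize_half]; positivity
  have hd1 : (1 : ℝ) ≤ d := by exact_mod_cast hd
  set τ := δ ^ 3 / (3456 * (d : ℝ) ^ 3)
  by_cases hj : ∃ j, i₀ ≠ j
  · obtain ⟨j, hj⟩ := hj
    refine le_trans (measure_mono fun q hq => ?_) (uniformSphere_anticoncentration (e := e) hj
      (inner ℝ (e i₀) b / pertSize β ρ l (1 / 2)) hδ hδ1)
    simp only [Set.mem_ofPred_eq] at hq ⊢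
    by_contra! hge
    refine absurd (solverOut_cubic_le hd hβ hρ hl hρl hδ hδ1 hA hAβ hD hmin hu hlow (q := q)
      (by simp) fun _ => ?_) (not_le.2 hq)
    rw [inner_add_right, real_inner_smul_right]
    set σ := pertSize β ρ l (1 / 2)
    rw [show inner ℝ (e i₀) b + σ * inner ℝ (e i₀) (q : E d) =
      σ * (inner ℝ (e i₀) (q : E d) + inner ℝ (e i₀) b / σ) by field_simp; ring, abs_mul,
      abs_of_pos hσ0]
    gcongr
  · push Not at hj
    have : Subsingleton (Fin d) := ⟨fun a c => (hj a).symm.trans (hj c)⟩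
    have hempty : {q : Metric.sphere (0 : E d) 1 |
        -(ρ * l ^ 3 / 12) < cubic A b ρ (solverOut A b β ρ l δ q)} = ∅ := by
      refine Set.eq_empty_of_forall_notMem fun q hq => ?_
      have hq1 : ‖(q : E d)‖ = 1 := by simp
      refine absurd (solverOut_cubic_le hd hβ hρ hl hρl hδ hδ1 hA hAβ hD hmin hu hlow (q := q)
        hq1 fun hfail => ?_) (not_le.2 hq)
      have hb : b = 0 := by
        by_contra hb
        have := cubic_cauchyPt_le_of_subsingleton hρ hA hb u
        have : 0 < ρ * l ^ 3 := by positivity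
        linarith
      have h1 : |inner ℝ (e i₀) (q : E d)| = 1 := by
        have h2 := inner_eq_sum e (q : E d) q
        rw [Fintype.sum_subsingleton _ i₀, real_inner_self_eq_norm_sq, hq1, ← sq, one_pow] at h2
        rw [← Real.sqrt_sq_eq_abs, ← h2, Real.sqrt_one]
      rw [hb, zero_add, real_inner_smul_right, abs_mul, h1, abs_of_pos hσ0]
      gcongr
      rw [div_le_one (by positivity)]
      have h3 : δ ^ 3 ≤ 1 := pow_le_one₀ hδ.le hδ1
      have h4 : 1 ≤ (d : ℝ) ^ 3 := one_le_pow₀ hd1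
      linarith
    rw [hempty]
    simp

/-! ### Measurability -/

section Measurability

variable {α : Type*} [MeasurableSpace α] {H : α → E d →L[ℝ] E d} {b b' x q : α → E d}

theorem measurable_clm_apply (hH : Measurable H) (hx : Measurable x) :
    Measurable fun a => H a (x a) :=
  ContinuousLinearMap.measurable_apply₂.comp (hH.prodMk hx)

theorem measurable_cubic (hH : Measurable H) (hb : Measurable b) (hx : Measurable x) (ρ : ℝ) :
    Measurable fun a => cubic (H a) (b a) ρ (x a) := by
  have hw := measurable_clm_apply hH hx
  unfold cubic
  -- The operator application becomes an opaque measurable function, and `fun_prop` handles the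
  -- rest.
  generalize hwd : (fun a => H a (x a)) = w at hw
  simp only [show ∀ a, H a (x a) = w a from congrFun hwd]
  fun_prop

theorem measurable_gdStep (hH : Measurable H) (hb : Measurable b) (hx : Measurable x) (ρ η : ℝ) :
    Measurable fun a => gdStep (H a) (b a) ρ η (x a) := by
  have hw := measurable_clm_apply hH hx
  unfold gdStep cubicGrad
  generalize hwd : (fun a => H a (x a)) = w at hw
  simp only [show ∀ a, H a (x a) = w a from congrFun hwd]
  fun_prop

theorem measurable_cauchyPt (hH : Measurable H) (hb : Measurable b) (ρ : ℝ) :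
    Measurable fun a => cauchyPt (H a) (b a) ρ := by
  have hw := measurable_clm_apply hH hb
  unfold cauchyPt cauchyRadius
  generalize hwd : (fun a => H a (b a)) = w at hw
  simp only [show ∀ a, H a (b a) = w a from congrFun hwd]
  fun_prop

theorem measurable_solveLoop (hH : Measurable H) (hb : Measurable b) (hb' : Measurable b')
    (ρ η thr : ℝ) (n : ℕ) : ∀ {x : α → E d}, Measurable x →
      Measurable fun a => (solveLoop (matOracle (H a)) (b a) (b' a) ρ η thr n (x a)).val := by
  induction n with
  | zero => intro x hx; exact hx
  | succ n ih =>
    intro x hx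
    have hs := measurable_gdStep hH hb' hx ρ η
    simp only [solveLoop_succ_val]
    exact Measurable.ite (measurableSet_le (measurable_cubic hH hb hs ρ) measurable_const) hs
      (ih hs)

theorem measurable_solverOut (hH : Measurable H) (hb : Measurable b) (hq : Measurable q)
    (β ρ l δ : ℝ) : Measurable fun a => solverOut (H a) (b a) β ρ l δ (q a) := by
  have hc := measurable_cauchyPt hH hb ρ
  have hb' : Measurable fun a => b a + pertSize β ρ l (1 / 2) • q a := by fun_prop
  simp only [solverOut, solveSubproblem_val]
  exact Measurable.ite (measurableSet_le (measurable_cubic hH hb hc ρ) measurable_const) hc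
    (measurable_solveLoop hH hb hb' _ _ _ _ (measurable_cauchyPt hH hb' ρ))

end Measurability

/-! ### Runs of the method -/

theorem finalLoop_succ (A : E d →L[ℝ] E d) (b : E d) (ρ η εg : ℝ) (n : ℕ) (x : E d) :
    finalLoop (matOracle A) b ρ η εg (n + 1) x =
      let r : Counted (Option (E d)) := if εg < ‖cubicGrad A b ρ x‖
        then finalLoop (matOracle A) b ρ η εg n (gdStep A b ρ η x) else ⟨some x, 0⟩
      ⟨r.val, 1 + r.cost⟩ := rfl

theorem exists_finalLoop_eq (A : E d →L[ℝ] E d) (b : E d) (ρ η εg : ℝ) (n : ℕ) :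
    ∀ x t, t < n → ‖cubicGrad A b ρ ((gdStep A b ρ η)^[t] x)‖ ≤ εg →
      ∃ s, ‖cubicGrad A b ρ ((gdStep A b ρ η)^[s] x)‖ ≤ εg ∧ ∃ c ≤ n,
        finalLoop (matOracle A) b ρ η εg n x = ⟨some ((gdStep A b ρ η)^[s] x), c⟩ := by
  induction n with
  | zero => intro x t ht; omega
  | succ n ih =>
    intro x t ht h
    simp only [finalLoop_succ]
    split_ifs with hc
    · obtain ⟨t, rfl⟩ : ∃ k, t = k + 1 := by
        rcases t with _ | t
        · exact absurd h (not_le.2 hc)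
        · exact ⟨t, rfl⟩
      rw [Function.iterate_succ_apply] at h
      obtain ⟨s, hs, c, hcn, he⟩ := ih _ t (by omega) h
      exact ⟨s + 1, hs, 1 + c, by omega, by rw [he]; rfl⟩
    · exact ⟨0, not_lt.1 hc, 1, by omega, rfl⟩

/-- The iterates of the method when all its steps are accepted. -/
def chain (g : E d → ℝ) (β ρ l δ : ℝ) (y₀ : E d) (q : ℕ → E d) : ℕ → E d
  | 0 => y₀
  | k + 1 => chain g β ρ l δ y₀ q k +
      solverOut (hessian g (chain g β ρ l δ y₀ q k)) (gradient g (chain g β ρ l δ y₀ q k)) β ρ l δ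
        (q k)

theorem majorizationLoop_succ (g : E d → ℝ) (β ρ ε δ : ℝ) (q : ℕ → E d) (m n k : ℕ) (y : E d) :
    majorizationLoop g β ρ ε δ q m (n + 1) k y =
      let S := solveSubproblem (matOracle (hessian g y)) (gradient g y) β ρ (1 / (10 * β))
        √(ε / (9 * ρ)) (1 / 2) δ (q k)
      let F := solveFinalSubproblem (matOracle (hessian g y)) (gradient g y) ρ (1 / (10 * β))
        (ε / 2) m
      let r : Counted (Option (E d)) :=
        if g (y + S.val) ≤ g y - Kprog * ε ^ (3 / 2 : ℝ) * ρ ^ (-(1 / 2) : ℝ) then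
          majorizationLoop g β ρ ε δ q m n (k + 1) (y + S.val)
        else ⟨F.val.map fun Δ' => y + Δ', F.cost⟩
      ⟨r.val, 1 + (S.cost + r.cost)⟩ := rfl

/-- Each iteration costs one gradient and at most `3 + 2T` products, where `T` is `maxSteps`; the
final stage costs `c`. -/
theorem exists_majorizationLoop_eq (g : E d → ℝ) (β ρ ε δ : ℝ) (y₀ : E d) (q : ℕ → E d) (M : ℕ)
    {l D : ℝ} (hl : √(ε / (9 * ρ)) = l)
    (hD : Kprog * ε ^ (3 / 2 : ℝ) * ρ ^ (-(1 / 2) : ℝ) = D) {m : ℕ} :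
    ∀ {k : ℕ} {u : E d} {c : ℕ},
    (∀ j < m, g (chain g β ρ l δ y₀ q (k + j + 1)) ≤ g (chain g β ρ l δ y₀ q (k + j)) - D) →
    (¬ g (chain g β ρ l δ y₀ q (k + m + 1)) ≤ g (chain g β ρ l δ y₀ q (k + m)) - D) →
    solveFinalSubproblem (matOracle (hessian g (chain g β ρ l δ y₀ q (k + m))))
      (gradient g (chain g β ρ l δ y₀ q (k + m))) ρ (1 / (10 * β)) (ε / 2) M = ⟨some u, c⟩ →
    ∃ N ≤ (m + 1) * (4 + 2 * maxSteps d ρ (1 / (10 * β)) l (1 / 2) δ) + c,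
      majorizationLoop g β ρ ε δ q M (m + 1) k (chain g β ρ l δ y₀ q k) =
        ⟨some (chain g β ρ l δ y₀ q (k + m) + u), N⟩ := by
  induction m with
  | zero =>
    intro k u c _ hfail hF
    rw [add_zero] at hfail hF
    have hcost := solveSubproblem_cost_le (hessian g (chain g β ρ l δ y₀ q k))
      (gradient g (chain g β ρ l δ y₀ q k)) β ρ (1 / (10 * β)) l (1 / 2) δ (q k)
    rw [majorizationLoop_succ]
    simp only [hl, hD, hF]
    rw [chain, solverOut] at hfail
    rw [if_neg hfail]
    refine ⟨_, ?_, rfl⟩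
    simp only
    omega
  | succ m ih =>
    intro k u c hpass hfail hF
    have hcost := solveSubproblem_cost_le (hessian g (chain g β ρ l δ y₀ q k))
      (gradient g (chain g β ρ l δ y₀ q k)) β ρ (1 / (10 * β)) l (1 / 2) δ (q k)
    have e : ∀ j, k + (j + 1) = k + 1 + j := fun j => by omega
    obtain ⟨N, hN, he⟩ := ih (k := k + 1) (u := u) (c := c)
      (fun j hj => by have := hpass (j + 1) (by omega); rwa [e] at this)
      (by rwa [e] at hfail) (by rwa [e] at hF)
    have h0 := hpass 0 (by omega)
    rw [add_zero, chain, solverOut] at h0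
    rw [chain, solverOut] at he
    rw [majorizationLoop_succ]
    simp only [hl, hD]
    rw [if_pos h0, he, e m]
    refine ⟨_, ?_, rfl⟩
    simp only
    rw [add_mul (m + 1) 1]
    omega

theorem rpow_three_halves {ρ l : ℝ} (hρ : 0 < ρ) (hl : 0 < l) :
    (9 * ρ * l ^ 2) ^ (3 / 2 : ℝ) = 27 * ρ * √ρ * l ^ 3 := by
  have e : 9 * ρ * l ^ 2 = (3 * √ρ * l) ^ 2 := by
    rw [mul_pow, mul_pow, Real.sq_sqrt hρ.le]; norm_num
  rw [e, ← Real.rpow_natCast, ← Real.rpow_mul (by positivity)]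
  norm_num
  rw [show (3 * √ρ * l) ^ 3 = 27 * (√ρ ^ 2) * √ρ * l ^ 3 by ring, Real.sq_sqrt hρ.le]

/-- The constant `1/324` is chosen so that `27/324 = 1/12`: the required decrease of `g` is the
model decrease asked of the solver. -/
theorem progress_eq {ρ l : ℝ} (hρ : 0 < ρ) (hl : 0 < l) :
    Kprog * (9 * ρ * l ^ 2) ^ (3 / 2 : ℝ) * ρ ^ (-(1 / 2) : ℝ) = ρ * l ^ 3 / 12 := by
  rw [rpow_three_halves hρ hl, Real.rpow_neg hρ.le, ← Real.sqrt_eq_rpow, Kprog]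
  have : 0 < √ρ := Real.sqrt_pos.2 hρ
  field_simp
  norm_num

theorem Kmax_eq (g : E d → ℝ) (glb : ℝ) {ρ l : ℝ} (hρ : 0 < ρ) (hl : 0 < l) (y₀ : E d) :
    Kmax g glb ρ (9 * ρ * l ^ 2) y₀ = ⌈(g y₀ - glb) / (ρ * l ^ 3 / 12)⌉₊ := by
  rw [Kmax, rpow_three_halves hρ hl, Kprog]
  have : 0 < √ρ := Real.sqrt_pos.2 hρ
  congr 1
  field_simp
  ring

/-- A Cauchy point outside the ball could be shrunk to a low value inside it, so the Cauchy step is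
short and `b` is small. -/
theorem regime_of_forall {A : E d →L[ℝ] E d} {b : E d} {β ρ l : ℝ} (hβ : 0 < β) (hρ : 0 < ρ)
    (hl : 0 < l) (hρl : ρ * l ≤ β / 3) (hA : ∀ x y, inner ℝ (A x) y = inner ℝ x (A y))
    (hAβ : ‖A‖ ≤ β) (hu : ∀ u, ‖u‖ ≤ l → -(ρ * l ^ 3 / 6) < cubic A b ρ u) :
    Regime A b β ρ := by
  refine ⟨hβ, hρ, hA, hAβ, ?_⟩
  have hn : ‖cauchyPt A b ρ‖ ≤ l := by
    by_contra! hlt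
    obtain ⟨u, h1, h2⟩ := exists_le_of_norm_ge hρ hl
      (inner_cauchyPt_cubicGrad (A := A) (b := b) hρ).le (inner_cauchyPt_le hρ) hlt.le
    exact absurd h2 (not_le.2 (hu u h1))
  have hb := norm_le_of_norm_cauchyPt_le hρ hβ hAβ hl hn
  have h1 : ρ * ‖b‖ ≤ (β + ρ * l) * (ρ * l) := by
    calc _ ≤ ρ * ((β + ρ * l) * l) := by gcongr
      _ = _ := by ring
  have h2 : 0 < ρ * l := by positivity
  nlinarith

/-- The final stage, entered at a point where the model has no low value. -/
theorem exists_solveFinalSubproblem_eq {g : E d → ℝ} {glb β ρ l : ℝ} (hβ : 0 < β) (hρ : 0 < ρ)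
    (hl : 0 < l) (hρl : ρ * l ≤ β / 3) (hg : IsAdmissible g glb β ρ) {y : E d}
    (hu : ∀ u, ‖u‖ ≤ l → -(ρ * l ^ 3 / 6) < cubic (hessian g y) (gradient g y) ρ u) :
    ∃ u, IsSecondOrderStationary g ρ (9 * ρ * l ^ 2) (y + u) ∧
      ∃ c ≤ 2 * ⌈10 * β / (ρ * l)⌉₊ + 1,
        solveFinalSubproblem (matOracle (hessian g y)) (gradient g y) ρ (1 / (10 * β))
          (9 * ρ * l ^ 2 / 2) (2 * ⌈10 * β / (ρ * l)⌉₊) = ⟨some u, c⟩ := by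
  have hR := regime_of_forall hβ hρ hl hρl (hessian_symm hg.contDiff y) (norm_hessian_le hβ.le hg y)
    hu
  have hX := descends_gdIter hR
  obtain ⟨t, ht, hsmall⟩ := hX.exists_small_grad hR hl hu (Nat.le_ceil _)
  obtain ⟨s, hs, c, hc, he⟩ := exists_finalLoop_eq (hessian g y) (gradient g y) ρ (1 / (10 * β))
    (9 * ρ * l ^ 2 / 2) _ (cauchyPt (hessian g y) (gradient g y) ρ) t ht hsmall
  refine ⟨_, isSecondOrderStationary_of_small hρ hl hg (hX.norm_lt hρ hl hu s).le
    (lower_bound_of_forall_cubic hl hu) hs, 1 + c, by omega, ?_⟩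
  have : ∀ n, solveFinalSubproblem (matOracle (hessian g y)) (gradient g y) ρ (1 / (10 * β))
      (9 * ρ * l ^ 2 / 2) n =
      ⟨(finalLoop (matOracle (hessian g y)) (gradient g y) ρ (1 / (10 * β)) (9 * ρ * l ^ 2 / 2) n
        (cauchyPt (hessian g y) (gradient g y) ρ)).val,
      1 + (finalLoop (matOracle (hessian g y)) (gradient g y) ρ (1 / (10 * β)) (9 * ρ * l ^ 2 / 2) n
        (cauchyPt (hessian g y) (gradient g y) ρ)).cost⟩ := fun _ => rfl
  rw [this, he]
  rfl

/-- If the subproblem solver never fails where it should succeed, the method returns a second-order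
stationary point. -/
theorem exists_returns {g : E d → ℝ} {glb β ρ l δ : ℝ} {y₀ : E d} {q : ℕ → E d}
    (hβ : 0 < β) (hρ : 0 < ρ) (hl : 0 < l) (hρl : ρ * l ≤ β / 3)
    (hg : IsAdmissible g glb β ρ) {K : ℕ} (hK : Kmax g glb ρ (9 * ρ * l ^ 2) y₀ = K)
    {Y : ℕ → E d} (hY : chain g β ρ l (δ / K) y₀ q = Y)
    (hsolve : ∀ k < K,
      (∃ u, ‖u‖ ≤ l ∧ cubic (hessian g (Y k)) (gradient g (Y k)) ρ u ≤ -(ρ * l ^ 3 / 6)) →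
      cubic (hessian g (Y k)) (gradient g (Y k)) ρ
        (solverOut (hessian g (Y k)) (gradient g (Y k)) β ρ l (δ / K) (q k)) ≤
          -(ρ * l ^ 3 / 12)) :
    ∃ y N, Returns g glb β ρ (9 * ρ * l ^ 2) δ y₀ q y N ∧
      IsSecondOrderStationary g ρ (9 * ρ * l ^ 2) y ∧
      N ≤ (K + 1) * (4 + 2 * maxSteps d ρ (1 / (10 * β)) l (1 / 2) (δ / K)) +
        (2 * ⌈10 * β / (ρ * l)⌉₊ + 1) := by
  have hD := progress_eq hρ hl
  set D := ρ * l ^ 3 / 12 with hDd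
  have hD0 : 0 < D := by positivity
  have hlq : √(9 * ρ * l ^ 2 / (9 * ρ)) = l := by
    rw [show 9 * ρ * l ^ 2 / (9 * ρ) = l ^ 2 by field_simp, Real.sqrt_sq hl.le]
  have hKD : g y₀ - glb ≤ K * D := by
    rw [← hK, Kmax_eq g glb hρ hl, ← div_le_iff₀ hD0]
    exact Nat.le_ceil _
  have hY0 : Y 0 = y₀ := by rw [← hY]; rfl
  have hYs : ∀ k, Y (k + 1) = Y k +
      solverOut (hessian g (Y k)) (gradient g (Y k)) β ρ l (δ / K) (q k) := fun k => by
    rw [← hY]; rfl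
  have hdec : ∀ m, (∀ j < m, g (Y (j + 1)) ≤ g (Y j) - D) → g (Y m) ≤ g y₀ - m * D := by
    intro m
    induction m with
    | zero => intro _; simp [hY0]
    | succ m ih =>
      intro h
      have h1 := ih fun j hj => h j (by omega)
      have h2 := h m (by omega)
      push_cast
      linarith
  have hex : ∃ m, ¬ g (Y (m + 1)) ≤ g (Y m) - D := by
    by_contra! hall
    have h1 := hdec (K + 1) fun j _ => hall j
    have h2 := hg.lower_bound (Y (K + 1))
    push_cast at h1
    linarith
  classical
  set m := Nat.find hex
  have hfail : ¬ g (Y (m + 1)) ≤ g (Y m) - D := Nat.find_spec hex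
  have hpass : ∀ j < m, g (Y (j + 1)) ≤ g (Y j) - D := fun j hj => not_not.1 (Nat.find_min hex hj)
  have hgm := hdec m hpass
  have hmK : m ≤ K := by
    by_contra! hlt
    have h1 : ((K : ℝ) + 1) * D ≤ m * D := by
      gcongr; exact_mod_cast hlt
    have h2 := hg.lower_bound (Y m)
    linarith
  have hu : ∀ u, ‖u‖ ≤ l →
      -(ρ * l ^ 3 / 6) < cubic (hessian g (Y m)) (gradient g (Y m)) ρ u := by
    intro u hul
    by_contra! hlow
    -- Before iteration `K`, a low value would have led to an acceptable step. At iteration `K` the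
    -- value of `g` is already at most `glb`, so a low value contradicts the lower bound with no
    -- appeal to the solver. Hence only `K` calls must succeed.
    rcases hmK.lt_or_eq with hlt | heq
    · have h1 := hsolve m hlt ⟨u, hul, hlow⟩
      have h2 := le_add_cubic hg (Y m)
        (solverOut (hessian g (Y m)) (gradient g (Y m)) β ρ l (δ / K) (q m))
      rw [← hYs] at h2
      exact hfail (by linarith)
    · have h1 := le_add_cubic hg (Y m) u
      have h2 := hg.lower_bound (Y m + u)
      rw [show (m : ℝ) = K by exact_mod_cast heq] at hgm
      have : 0 < ρ * l ^ 3 := by positivity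
      linarith
  obtain ⟨u, hsosp, c, hc, he⟩ := exists_solveFinalSubproblem_eq hβ hρ hl hρl hg hu
  obtain ⟨N, hN, hloop⟩ := exists_majorizationLoop_eq g β ρ (9 * ρ * l ^ 2) (δ / K) y₀ q
    (2 * ⌈10 * β / (ρ * l)⌉₊) hlq hD (m := m) (k := 0) (u := u) (c := c)
    (by simpa only [zero_add, hY] using hpass) (by simpa only [zero_add, hY] using hfail)
    (by simpa only [zero_add, hY] using he)
  rw [zero_add, hY, hY0] at hloop
  refine ⟨Y m + u, N, ⟨m + 1, _, by rw [hK]; exact hloop⟩, hsosp, hN.trans ?_⟩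
  gcongr

/-! ### The probability of success -/

theorem measure_prodMk_mem_le {Ω S T : Type*} [MeasurableSpace Ω] [MeasurableSpace S]
    [MeasurableSpace T] {μ : Measure Ω} [IsProbabilityMeasure μ] {X : Ω → S} {Z : Ω → T}
    (hX : Measurable X) (hZ : Measurable Z) (hind : IndepFun X Z μ) {W : Set (S × T)}
    (hW : MeasurableSet W) {c : ENNReal} (hc : ∀ s, μ.map Z (Prod.mk s ⁻¹' W) ≤ c) :
    μ {ω | (X ω, Z ω) ∈ W} ≤ c := by
  have := Measure.isProbabilityMeasure_map (μ := μ) hX.aemeasurable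
  have := Measure.isProbabilityMeasure_map (μ := μ) hZ.aemeasurable
  have h1 := (indepFun_iff_map_prod_eq_prod_map_map hX.aemeasurable hZ.aemeasurable).1 hind
  calc μ {ω | (X ω, Z ω) ∈ W} = μ.map (fun ω => (X ω, Z ω)) W :=
        (Measure.map_apply (hX.prodMk hZ) hW).symm
    _ = ∫⁻ s, μ.map Z (Prod.mk s ⁻¹' W) ∂(μ.map X) := by rw [h1, Measure.prod_apply hW]
    _ ≤ ∫⁻ _, c ∂(μ.map X) := lintegral_mono hc
    _ = c := by simp

/-- Iterate `k` uses only the samples with index below `k`, which makes it independent of sample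
`k`. -/
theorem exists_measurable_chain {g : E d → ℝ} (hg : ContDiff ℝ 2 g) (β ρ l δ : ℝ) (y₀ : E d)
    {Ω : Type*} (q : ℕ → Ω → Metric.sphere (0 : E d) 1) (k : ℕ) :
    ∃ F : (Finset.range k → Metric.sphere (0 : E d) 1) → E d, Measurable F ∧
      ∀ ω, chain g β ρ l δ y₀ (fun i => (q i ω : E d)) k = F fun i => q i ω := by
  induction k with
  | zero => exact ⟨fun _ => y₀, measurable_const, fun _ => rfl⟩
  | succ k ih =>
    obtain ⟨F, hF, he⟩ := ih
    let r : (Finset.range (k + 1) → Metric.sphere (0 : E d) 1) →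
        (Finset.range k → Metric.sphere (0 : E d) 1) :=
      fun s i => s ⟨i, Finset.mem_range.2 ((Finset.mem_range.1 i.2).trans (Nat.lt_succ_self k))⟩
    have hr : Measurable r := measurable_pi_lambda _ fun i => measurable_pi_apply _
    have hFr := hF.comp hr
    refine ⟨fun s => F (r s) + solverOut (hessian g (F (r s))) (gradient g (F (r s))) β ρ l δ
      (s ⟨k, Finset.self_mem_range_succ k⟩), ?_, fun ω => ?_⟩
    · exact hFr.add (measurable_solverOut ((continuous_hessian hg).measurable.comp hFr)
        ((contDiff_gradient hg).continuous.measurable.comp hFr)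
        (measurable_subtype_coe.comp (measurable_pi_apply _)) β ρ l δ)
    · rw [chain, he]

theorem indepFun_chain {g : E d → ℝ} (hg : ContDiff ℝ 2 g) (β ρ l δ : ℝ) (y₀ : E d)
    {Ω : Type*} [MeasurableSpace Ω] {μ : Measure Ω} {q : ℕ → Ω → Metric.sphere (0 : E d) 1}
    (hq : ∀ k, Measurable (q k)) (hind : iIndepFun q μ) (k : ℕ) :
    Measurable (fun ω => chain g β ρ l δ y₀ (fun i => (q i ω : E d)) k) ∧
      IndepFun (fun ω => chain g β ρ l δ y₀ (fun i => (q i ω : E d)) k) (q k) μ := by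
  obtain ⟨F, hF, he⟩ := exists_measurable_chain hg β ρ l δ y₀ q k
  simp only [he]
  refine ⟨hF.comp (measurable_pi_lambda _ fun i => hq i), ?_⟩
  have h := hind.indepFun_finset (Finset.range k) {k} (by simp) hq
  exact h.comp hF (measurable_pi_apply (⟨k, Finset.mem_singleton_self k⟩ : ({k} : Finset ℕ)))

/-- A union bound for events that depend on the past and on a fresh sample, where only those pasts
count for which the event is unlikely. -/
theorem measure_exists_mem_le {Ω S T : Type*} [MeasurableSpace Ω] [MeasurableSpace S]
    [MeasurableSpace T] {μ : Measure Ω} [IsProbabilityMeasure μ] {ν : Measure T}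
    [IsProbabilityMeasure ν] {X : ℕ → Ω → S} {Z : ℕ → Ω → T} (hX : ∀ k, Measurable (X k))
    (hZ : ∀ k, Measurable (Z k)) (hind : ∀ k, IndepFun (X k) (Z k) μ) (hlaw : ∀ k, μ.map (Z k) = ν)
    {W : Set (S × T)} (hW : MeasurableSet W) (c : ENNReal) (K : ℕ) :
    μ {ω | ∃ k < K, (X k ω, Z k ω) ∈ W ∧ ν (Prod.mk (X k ω) ⁻¹' W) ≤ c} ≤ K * c := by
  -- Discarding the pasts with a likely event leaves a measurable set all of whose sections have
  -- measure at most `c`.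
  let V : Set (S × T) := W ∩ {p | ν (Prod.mk p.1 ⁻¹' W) ≤ c}
  have hV : MeasurableSet V := hW.inter
    (measurableSet_le ((measurable_measure_prodMk_left hW).comp measurable_fst) measurable_const)
  have hVsec : ∀ s, ν (Prod.mk s ⁻¹' V) ≤ c := by
    intro s
    by_cases hs : ν (Prod.mk s ⁻¹' W) ≤ c
    · exact (measure_mono fun t ht => ht.1).trans hs
    · rw [show Prod.mk s ⁻¹' V = ∅ from Set.eq_empty_of_forall_notMem fun t ht => hs ht.2]
      simp
  calc _ ≤ μ (⋃ k ∈ Finset.range K, {ω | (X k ω, Z k ω) ∈ V}) := by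
        refine measure_mono fun ω hω => ?_
        obtain ⟨k, hk, h1, h2⟩ := hω
        exact Set.mem_biUnion (Finset.mem_coe.2 (Finset.mem_range.2 hk)) ⟨h1, h2⟩
    _ ≤ ∑ k ∈ Finset.range K, μ {ω | (X k ω, Z k ω) ∈ V} := measure_biUnion_finset_le _ _
    _ ≤ ∑ _k ∈ Finset.range K, c := Finset.sum_le_sum fun k _ =>
        measure_prodMk_mem_le (hX k) (hZ k) (hind k) hV fun s => by rw [hlaw]; exact hVsec s
    _ = _ := by simp

/-- With probability at least `1 - K δ`, the first `K` calls of the subproblem solver all succeed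
if they should. -/
theorem measure_solver_fails_le (hd : 0 < d) {g : E d → ℝ} {glb β ρ l δ : ℝ} (hβ : 0 < β)
    (hρ : 0 < ρ) (hl : 0 < l) (hρl : ρ * l ≤ β / 3) (hδ : 0 < δ) (hδ1 : δ ≤ 1)
    (hg : IsAdmissible g glb β ρ) (y₀ : E d)
    {Ω : Type*} [MeasurableSpace Ω] {μ : Measure Ω} [IsProbabilityMeasure μ]
    {q : ℕ → Ω → Metric.sphere (0 : E d) 1} (hq : ∀ k, Measurable (q k)) (hind : iIndepFun q μ)
    (hlaw : ∀ k, μ.map (q k) = uniformSphere d) (K : ℕ) :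
    μ {ω | ∃ k < K, ∃ y, chain g β ρ l δ y₀ (fun i => (q i ω : E d)) k = y ∧
      (∃ u, ‖u‖ ≤ l ∧ cubic (hessian g y) (gradient g y) ρ u ≤ -(ρ * l ^ 3 / 6)) ∧
      -(ρ * l ^ 3 / 12) < cubic (hessian g y) (gradient g y) ρ
        (solverOut (hessian g y) (gradient g y) β ρ l δ (q k ω))} ≤
      K * ENNReal.ofReal δ := by
  have hprob : IsProbabilityMeasure (uniformSphere d) :=
    hlaw 0 ▸ Measure.isProbabilityMeasure_map (hq 0).aemeasurable
  let S : Set (E d × Metric.sphere (0 : E d) 1) := {p | -(ρ * l ^ 3 / 12) <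
    cubic (hessian g p.1) (gradient g p.1) ρ
      (solverOut (hessian g p.1) (gradient g p.1) β ρ l δ p.2)}
  have hmem : ∀ y s, (y, s) ∈ S ↔ -(ρ * l ^ 3 / 12) < cubic (hessian g y) (gradient g y) ρ
      (solverOut (hessian g y) (gradient g y) β ρ l δ s) := fun _ _ => Iff.rfl
  have hS : MeasurableSet S := by
    have hH : Measurable fun p : E d × Metric.sphere (0 : E d) 1 => hessian g p.1 :=
      (continuous_hessian hg.contDiff).measurable.comp measurable_fst
    have hG : Measurable fun p : E d × Metric.sphere (0 : E d) 1 => gradient g p.1 :=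
      (contDiff_gradient hg.contDiff).continuous.measurable.comp measurable_fst
    have hq : Measurable fun p : E d × Metric.sphere (0 : E d) 1 => (p.2 : E d) :=
      measurable_subtype_coe.comp measurable_snd
    exact measurableSet_lt measurable_const (measurable_cubic hH hG
      (measurable_solverOut hH hG hq β ρ l δ) ρ)
  clear_value S
  have hsec : ∀ y, (∃ u, ‖u‖ ≤ l ∧ cubic (hessian g y) (gradient g y) ρ u ≤ -(ρ * l ^ 3 / 6)) →
      uniformSphere d (Prod.mk y ⁻¹' S) ≤ ENNReal.ofReal δ := by
    rintro y ⟨u, hu, hlow⟩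
    have h1 := uniformSphere_solver_fails_le hd hβ hρ hl hρl hδ hδ1 (hessian_symm hg.contDiff y)
      (norm_hessian_le hβ.le hg y) hu hlow
    refine le_trans (measure_mono fun s hs => ?_) h1
    exact (hmem y s).1 hs
  have hchain := indepFun_chain hg.contDiff β ρ l δ y₀ hq hind
  have key := measure_exists_mem_le (fun k => (hchain k).1) hq (fun k => (hchain k).2) hlaw hS
    (ENNReal.ofReal δ) K
  refine le_trans (measure_mono fun ω hω => ?_) key
  obtain ⟨k, hk, y, rfl, hlow, hlt⟩ := hω
  exact ⟨k, hk, (hmem _ _).2 hlt, hsec _ hlow⟩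

/-! ### The query count -/

/-- By `log c ≤ c - 1` and `1 ≤ M`, a constant inside the logarithm becomes a factor outside. -/
theorem log_mul_le {c X M : ℝ} (hc : 1 ≤ c) (hX : 0 < X) (hM : Real.log X ≤ M) (hM1 : 1 ≤ M) :
    Real.log (c * X) ≤ c * M := by
  rw [Real.log_mul (by positivity) hX.ne']
  have := Real.log_le_sub_one_of_pos (show 0 < c by linarith)
  nlinarith

theorem maxSteps_le {d : ℕ} {β ρ l δ L : ℝ} (hN : 30 ≤ 10 * β / (ρ * l))
    (h1 : Real.log (1 + √(d : ℝ) / δ) ≤ L) (h2 : Real.log (12 * (10 * β / (ρ * l))) ≤ L)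
    (hδ : 0 < δ) :
    (maxSteps d ρ (1 / (10 * β)) l (1 / 2) δ : ℝ) ≤ 18240 * (10 * β / (ρ * l)) * L + 1 := by
  have e1 : 240 / (1 / (10 * β) * ρ * l * (1 / 2)) = 480 * (10 * β / (ρ * l)) := by
    field_simp; ring
  have e2 : 6 / (1 / (10 * β) * ρ * l * (1 / 2)) = 12 * (10 * β / (ρ * l)) := by
    field_simp; ring
  rw [maxSteps, e1, e2]
  generalize 10 * β / (ρ * l) = N at *
  have h0 : 0 ≤ Real.log (1 + √(d : ℝ) / δ) := Real.log_nonneg (by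
    have : 0 ≤ √(d : ℝ) / δ := by positivity
    linarith)
  have h0' : 0 ≤ Real.log (12 * N) := Real.log_nonneg (by linarith)
  refine (Nat.ceil_lt_add_one (by positivity)).le.trans ?_
  have : 480 * N * (6 * Real.log (1 + √(d : ℝ) / δ) + 32 * Real.log (12 * N)) ≤
      480 * N * (38 * L) := mul_le_mul_of_nonneg_left (by linarith) (by linarith)
  linarith

/-- In the application `P = G/(ρl³)` measures the outer iterations, `N = 10β/(ρl)` the inner ones,
and `Q = βG/ε²`. -/
theorem total_le {K T P N Q M n : ℝ} (hN : 30 ≤ N) (hP : 27 ≤ P) (hPN : P * N = 810 * Q)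
    (hM : 1 ≤ M) (hK : K + 1 ≤ 14 * P) (hT0 : 0 ≤ T) (hT : T ≤ 18240 * N * (400 * M) + 1)
    (hn : n ≤ N + 1) : (K + 1) * (4 + 2 * T) + (2 * n + 1) ≤ 10 ^ 12 * Q * M := by
  have hNM : N * 1 ≤ N * M := mul_le_mul_of_nonneg_left hM (by linarith)
  have h1 : 4 + 2 * T ≤ 15000000 * (N * M) := by linarith
  have h3 : (K + 1) * (4 + 2 * T) ≤ 14 * P * (15000000 * (N * M)) :=
    mul_le_mul hK h1 (by linarith) (by linarith)
  have h4 : 14 * P * (15000000 * (N * M)) = 170100000000 * (Q * M) := by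
    linear_combination 14 * 15000000 * M * hPN
  have h6 : 27 * N ≤ P * N := mul_le_mul_of_nonneg_right hP (by linarith)
  have h5 : Q * 1 ≤ Q * M := mul_le_mul_of_nonneg_left hM (by linarith)
  linarith

/-- The number of queries is within the claimed bound. -/
theorem queries_le {d K : ℕ} (hd : 0 < d) {β ρ l δ G : ℝ} (hβ : 0 < β) (hρ : 0 < ρ) (hl : 0 < l)
    (hρl : ρ * l ≤ β / 3) (hl3 : 27 * (ρ * l ^ 3) ≤ 1) (hδ : 0 < δ) (hδ1 : δ ≤ 1)
    (hG : 1 ≤ G) (hK0 : 0 < K) (hK : (K : ℝ) ≤ G / (ρ * l ^ 3 / 12) + 1) :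
    (((K + 1) * (4 + 2 * maxSteps d ρ (1 / (10 * β)) l (1 / 2) (δ / K)) +
        (2 * ⌈10 * β / (ρ * l)⌉₊ + 1) : ℕ) : ℝ) ≤
      10 ^ 12 * (β * G / (9 * ρ * l ^ 2) ^ 2) *
        max 1 (Real.log (d / δ * (β * G / (9 * ρ * l ^ 2) ^ 2))) := by
  have hN : 30 ≤ 10 * β / (ρ * l) := by rw [le_div_iff₀ (by positivity)]; linarith
  have hd1 : (1 : ℝ) ≤ d := by exact_mod_cast hd
  have hK1 : (1 : ℝ) ≤ K := by exact_mod_cast hK0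
  set Q := β * G / (9 * ρ * l ^ 2) ^ 2 with hQd
  set N := 10 * β / (ρ * l) with hNd
  set P := G / (ρ * l ^ 3) with hPd
  have hP : 27 ≤ P := by
    rw [hPd, le_div_iff₀ (by positivity)]; linarith
  have hPN : P * N = 810 * Q := by rw [hPd, hNd, hQd]; field_simp; norm_num
  have hNQ : N ≤ 30 * Q := by nlinarith
  have hQ1 : 1 ≤ Q := by nlinarith
  have hPQ : P ≤ 27 * Q := by nlinarith
  have hKP : (K : ℝ) ≤ 13 * P := by
    have : G / (ρ * l ^ 3 / 12) = 12 * P := by rw [hPd]; field_simp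
    linarith
  set X := d / δ * Q with hXd
  have hdδ : 1 ≤ d / δ := by rw [le_div_iff₀ hδ]; linarith
  have hQX : Q ≤ X := by rw [hXd]; nlinarith
  have hX1 : 1 ≤ X := hQ1.trans hQX
  set M := max 1 (Real.log X)
  have hM1 : 1 ≤ M := le_max_left _ _
  have hMX : Real.log X ≤ M := le_max_right _ _
  have hL1 : Real.log (1 + √(d : ℝ) / (δ / K)) ≤ 400 * M := by
    refine le_trans (Real.log_le_log (by positivity) ?_)
      (log_mul_le (c := 400) (by norm_num) (by linarith) hMX hM1)
    have h1 : √(d : ℝ) ≤ d := by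
      rw [Real.sqrt_le_left (by positivity)]; nlinarith
    have h2 : √(d : ℝ) / (δ / K) ≤ 351 * X := by
      calc √(d : ℝ) / (δ / K) ≤ d / (δ / K) := by gcongr
        _ = d / δ * K := by field_simp
        _ ≤ d / δ * (351 * Q) := by gcongr; linarith
        _ = 351 * X := by rw [hXd]; ring
    linarith
  have hL2 : Real.log (12 * N) ≤ 360 * M := by
    refine le_trans (Real.log_le_log (by positivity) ?_)
      (log_mul_le (c := 360) (by norm_num) (by linarith) hMX hM1)
    linarith
  have hT := maxSteps_le hN hL1 (hL2.trans (by linarith)) (show 0 < δ / K by positivity)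
  have hC := (Nat.ceil_lt_add_one (show 0 ≤ N by linarith)).le
  push_cast
  exact total_le hN hP hPN hM1 (by linarith) (Nat.cast_nonneg _) hT hC

end CubicMajorization

end

/-! ### The main theorem -/

open CubicMajorization in
theorem mainTheorem4 :
    ∃ C : ℝ, 0 < C ∧
      ∀ (d : ℕ) (_ : 0 < d) (g : E d → ℝ) (glb β ρ ε δ : ℝ) (y₀ : E d)
        (_ : 0 < β) (_ : 0 < ρ) (_ : IsAdmissible g glb β ρ) (_ : glb < g y₀)
        (_ : 0 < ε) (_ : ε ≤ min (β ^ 2 / ρ) (ρ ^ (1 / 3 : ℝ)))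
        (_ : 0 < δ) (_ : δ ≤ 1)
        (Ω : Type*) [MeasurableSpace Ω] (μ : Measure Ω) [IsProbabilityMeasure μ]
        (q : ℕ → Ω → Metric.sphere (0 : E d) 1)
        (_ : ∀ k, Measurable (q k)) (_ : iIndepFun q μ)
        (_ : ∀ k, μ.map (q k) = uniformSphere d),
        μ {ω | ¬ ∃ (y : E d) (N : ℕ),
            Returns g glb β ρ ε δ y₀ (fun k => (q k ω : E d)) y N ∧
            IsSecondOrderStationary g ρ ε y ∧
            (N : ℝ) ≤ C * (β * ⌈g y₀ - glb⌉₊ / ε ^ 2) *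
              max 1 (Real.log (d / δ * (β * ⌈g y₀ - glb⌉₊ / ε ^ 2)))}
          ≤ ENNReal.ofReal δ := by
  refine ⟨10 ^ 12, by norm_num, ?_⟩
  intro d hd g glb β ρ ε δ y₀ hβ hρ hg hglb hε hεle hδ hδ1 Ω _ μ _ q hq hind hlaw
  obtain ⟨l, hl, rfl⟩ : ∃ l : ℝ, 0 < l ∧ ε = 9 * ρ * l ^ 2 := by
    refine ⟨√(ε / (9 * ρ)), by positivity, ?_⟩
    rw [Real.sq_sqrt (by positivity)]
    field_simp
  -- The two bounds on `ε` become `(3ρl)² ≤ β²` and `(27ρl³)² ≤ 1`.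
  have hρl : ρ * l ≤ β / 3 := by
    have h1 := hεle.trans (min_le_left _ _)
    rw [le_div_iff₀ hρ] at h1
    refine abs_le_of_sq_le_sq' ?_ (by positivity) |>.2
    linarith
  have hl3 : 27 * (ρ * l ^ 3) ≤ 1 := by
    have h1 := hεle.trans (min_le_right _ _)
    have h2 : (9 * ρ * l ^ 2) ^ 3 ≤ ρ := by
      calc (9 * ρ * l ^ 2) ^ 3 ≤ (ρ ^ (1 / 3 : ℝ)) ^ 3 := by gcongr
        _ = ρ := by rw [← Real.rpow_natCast, ← Real.rpow_mul hρ.le]; norm_num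
    have h3 : ρ * (27 * (ρ * l ^ 3)) ^ 2 ≤ ρ * 1 := by linarith
    have h4 := le_of_mul_le_mul_left h3 hρ
    exact (abs_le_of_sq_le_sq' (by linarith) zero_le_one).2
  have hKeq := Kmax_eq g glb hρ hl y₀
  obtain ⟨K, hK⟩ : ∃ K, Kmax g glb ρ (9 * ρ * l ^ 2) y₀ = K := ⟨_, rfl⟩
  have hgap : 0 < g y₀ - glb := by linarith
  have hK0 : 0 < K := by rw [← hK, hKeq, Nat.ceil_pos]; positivity
  have hK1 : (1 : ℝ) ≤ K := by exact_mod_cast hK0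
  have hG : (1 : ℝ) ≤ ⌈g y₀ - glb⌉₊ := by exact_mod_cast Nat.ceil_pos.2 hgap
  have hKG : (K : ℝ) ≤ ⌈g y₀ - glb⌉₊ / (ρ * l ^ 3 / 12) + 1 := by
    rw [← hK, hKeq]
    refine (Nat.ceil_lt_add_one (by positivity)).le.trans ?_
    gcongr
    exact Nat.le_ceil _
  have hδK : δ / K ≤ 1 := by rw [div_le_one (by positivity)]; linarith
  have hprob := measure_solver_fails_le hd hβ hρ hl hρl (show 0 < δ / K by positivity) hδK hg y₀
    hq hind hlaw K
  have hδe : (K : ENNReal) * ENNReal.ofReal (δ / K) = ENNReal.ofReal δ := by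
    rw [← ENNReal.ofReal_natCast, ← ENNReal.ofReal_mul (by positivity)]
    congr 1; field_simp
  rw [← hδe]
  -- Monotonicity of the outer measure suffices, so the failure event need not be measurable.
  refine le_trans (measure_mono fun ω hω => ?_) hprob
  by_contra hbad
  refine hω ?_
  obtain ⟨y, N, hret, hsosp, hN⟩ := exists_returns hβ hρ hl hρl hg hK rfl
    (q := fun k => (q k ω : E d)) fun k hk hlow =>
      not_lt.1 fun hlt => hbad ⟨k, hk, _, rfl, hlow, hlt⟩
  refine ⟨y, N, hret, hsosp, le_trans ?_ (queries_le hd hβ hρ hl hρl hl3 hδ hδ1 hG hK0 hKG)⟩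
  exact_mod_cast hN
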